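/- Let $N\ge 1$, let $\kappa$ be an indeterminate, and consider polynomials in $x_1,\dots,x_N$ over $\mathbb{Q}(\kappa)$. The symmetric group $S_N$ acts on polynomials by $wf(x)=f(xw)$ with $(xw)_i=x_{w(i)}$, and on compositions $\alpha\in\mathbb{N}_0^N$ by $(w\alpha)_i=\alpha_{w^{-1}(i)}$. For $1\le i\le N$ define $$\mathcal D_i f=\frac{\partial f}{\partial x_i}+\kappa\sum_{j\ne i}\frac{f-(i,j)f}{x_i-x_j},\qquad \mathcal U_i f=\mathcal D_i(x_if)-\kappa\sum_{j<i}(j,i)f .$$ For $\alpha\in\mathbb{N}_0^N$ let $$r(\alpha,i)=\#\{j:\alpha_j>\alpha_i\}+\#\{j\le i:\alpha_j=\alpha_i\},\qquad \xi_i(\alpha)=(N-r(\alpha,i))\kappa+\alpha_i+1,$$ let $|\alpha|=\sum_i\alpha_i$, and let $\alpha^+$ be the nonincreasing rearrangement of $\alpha$. Write $\alpha\succ\beta$ if $\alpha\ne\beta$ and $\sum_{i\le j}\alpha_i\ge\sum_{i\le j}\beta_i$ for all $1\le j\le N$; write $\alpha\vartriangleright\beta$ if $|\alpha|=|\beta|$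 and either $\alpha^+\succ\beta^+$, or $\alpha^+=\beta^+$ and $\alpha\succ\beta$. Define polynomials $p_\alpha$ by the generating function (as formal power series in $y_1,\dots,y_N$) $$\sum_{\alpha\in\mathbb{N}_0^N}p_\alpha(x)y^\alpha=\prod_{i=1}^N\Big((1-x_iy_i)^{-1}\prod_{j=1}^N(1-x_iy_j)^{-\kappa}\Big).$$ Then for every $\alpha\in\mathbb{N}_0^N$ there is exactly one polynomial $\zeta_\alpha$ (the $p$-monic nonsymmetric Jack polynomial) such that $\mathcal U_i\zeta_\alpha=\xi_i(\alpha)\zeta_\alpha$ for $1\le i\le N$ and $\zeta_\alpha=p_\alpha+\sum_{\beta\vartriangleright\alpha}A_{\beta\alpha}p_\beta$ with $A_{\beta\alpha}\in\mathbb{Q}(\kappa)$. Moreover, suppose that $\alpha\in\mathbb{N}_0^N$ is nonzero and that $m=\ell(\alpha):=\max\{j:\alpha_j>0\}$. Let $\theta_m=(1,2)(2,3)\cdots(m-1,m)\in S_N$ (the identity if $m=1$), let $\varepsilon(m)$ be the $m$-th standard basis vector, and let $\widetilde\alpha=\theta_m(\alpha-\varepsilon(m))=(\alpha_m-1,\alpha_1,\dots,\alpha_{m-1},0,\dots,0)$.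 Then $$\mathcal D_m\zeta_\alpha=\big((N+1-r(\alpha,m))\kappa+\alpha_m\big)\,\theta_m^{-1}\zeta_{\widetilde\alpha}.$$ -/

import Mathlib

namespace NonsymJack

open MvPolynomial

/-- The field `ℚ(κ)`, a simple transcendental extension of `ℚ`. -/
abbrev K : Type := RatFunc ℚ

/-- The formal parameter `κ`. -/
noncomputable def kappa : K := RatFunc.X

/-- Polynomials in `x_1, …, x_N` over `ℚ(κ)`; the variables are indexed by `Fin N`. -/
abbrev Poly (N : ℕ) : Type := MvPolynomial (Fin N) K

/-- The action of the symmetric group on polynomials, `(w f)(x) = f(xw)` with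
`(xw)_i = x_{w(i)}`; thus `w` sends the variable `x_i` to `x_{w(i)}`. -/
noncomputable def permAct {N : ℕ} (w : Equiv.Perm (Fin N)) (f : Poly N) : Poly N :=
  rename w f

/-- The action of the symmetric group on compositions, `(w α)_i = α_{w⁻¹(i)}`. -/
def compAct {N : ℕ} (w : Equiv.Perm (Fin N)) (α : Fin N → ℕ) : Fin N → ℕ :=
  fun i => α (w⁻¹ i)

theorem sub_dvd_sub_swap {N : ℕ} (i j : Fin N) (f : Poly N) :
    (X i - X j : Poly N) ∣ f - permAct (Equiv.swap i j) f := by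
  unfold permAct
  induction f using MvPolynomial.induction_on with
  | C a => simp
  | add p q hp hq =>
    have h := dvd_add hp hq
    rw [map_add]
    convert h using 1
    ring
  | mul_X p k hp =>
    have hk : (X i - X j : Poly N) ∣ X k - X (Equiv.swap i j k) := by
      by_cases h1 : k = i
      · subst h1
        simp
      · by_cases h2 : k = j
        · subst h2
          rw [Equiv.swap_apply_right]
          exact ⟨-1, by ring⟩
        · rw [Equiv.swap_apply_of_ne_of_ne h1 h2]
          simp
    rw [map_mul, rename_X]
    have h : p * X k - rename (Equiv.swap i j) p * X (Equiv.swap i j k)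
        = (p - rename (Equiv.swap i j) p) * X k
          + rename (Equiv.swap i j) p * (X k - X (Equiv.swap i j k)) := by ring
    rw [h]
    exact dvd_add (hp.mul_right _) (hk.mul_left _)

/-- The polynomial `(f - (i j) f) / (x_i - x_j)`; meant for `i ≠ j`. -/
noncomputable def divDiff {N : ℕ} (i j : Fin N) (f : Poly N) : Poly N :=
  Classical.choose (sub_dvd_sub_swap i j f)

theorem divDiff_spec {N : ℕ} (i j : Fin N) (f : Poly N) :
    f - permAct (Equiv.swap i j) f = (X i - X j) * divDiff i j f :=
  Classical.choose_spec (sub_dvd_sub_swap i j f)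

/-- The Dunkl operator
`D_i f = ∂f/∂x_i + κ ∑_{j ≠ i} (f - (i j) f) / (x_i - x_j)`. -/
noncomputable def dunkl {N : ℕ} (i : Fin N) (f : Poly N) : Poly N :=
  pderiv i f + kappa • ∑ j ∈ Finset.univ.erase i, divDiff i j f

/-- The operator `U_i f = D_i (x_i f) - κ ∑_{j < i} (j i) f`. -/
noncomputable def opU {N : ℕ} (i : Fin N) (f : Poly N) : Poly N :=
  dunkl i (X i * f) - kappa • ∑ j ∈ Finset.univ.filter (fun j => j < i),
    permAct (Equiv.swap j i) f

/-- The rank function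
`r(α,i) = #{j : α_j > α_i} + #{j : j ≤ i, α_j = α_i}`, with values in `{1, …, N}`. -/
def rank {N : ℕ} (α : Fin N → ℕ) (i : Fin N) : ℕ :=
  (Finset.univ.filter (fun j => α i < α j)).card
    + (Finset.univ.filter (fun j => j ≤ i ∧ α j = α i)).card

/-- The eigenvalue `ξ_i(α) = (N - r(α,i)) κ + α_i + 1`. -/
noncomputable def xi {N : ℕ} (α : Fin N → ℕ) (i : Fin N) : K :=
  ((N : K) - (rank α i : K)) * kappa + (α i : K) + 1

/-- The partition `α⁺`, the nonincreasing rearrangement of `α`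
(`Tuple.sort` sorts in nondecreasing order, `Fin.rev` reverses). -/
def plus {N : ℕ} (α : Fin N → ℕ) : Fin N → ℕ :=
  fun i => α (Tuple.sort α (Fin.rev i))

/-- `α ≻ β`: `α ≠ β` and every partial sum of `α` is at least that of `β`. -/
def Dominates {N : ℕ} (α β : Fin N → ℕ) : Prop :=
  α ≠ β ∧ ∀ j : Fin N, ∑ i ∈ Finset.Iic j, β i ≤ ∑ i ∈ Finset.Iic j, α i

/-- `α ▷ β`: `|α| = |β|`, and either `α⁺ ≻ β⁺`, or `α⁺ = β⁺` and `α ≻ β`. -/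
def TriangleGT {N : ℕ} (α β : Fin N → ℕ) : Prop :=
  ∑ i, α i = ∑ i, β i ∧
    (Dominates (plus α) (plus β) ∨ (plus α = plus β ∧ Dominates α β))

/-- The formal power series `(1 - x_i y_j)^{-t} = ∑_n (t)_n / n! (x_i y_j)^n` in the
variables `y`, with coefficients polynomials in `x`, where `(t)_n = t (t+1) ⋯ (t+n-1)`. -/
noncomputable def negPow {N : ℕ} (t : K) (i j : Fin N) : MvPowerSeries (Fin N) (Poly N) :=
  fun d => if d = Finsupp.single j (d j) then
    C ((ascPochhammer K (d j)).eval t / ((d j).factorial : K)) * X i ^ (d j) else 0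

/-- The generating function `∏_i ((1 - x_i y_i)^{-1} ∏_j (1 - x_i y_j)^{-κ})` of the `p`-basis. -/
noncomputable def pGen (N : ℕ) : MvPowerSeries (Fin N) (Poly N) :=
  ∏ i : Fin N, (negPow 1 i i * ∏ j : Fin N, negPow kappa i j)

/-- The polynomial `p_α`, the coefficient of `y^α` in the generating function. -/
noncomputable def p {N : ℕ} (α : Fin N → ℕ) : Poly N :=
  MvPowerSeries.coeff (Finsupp.equivFunOnFinite.symm α) (pGen N)

/-- `f` is a `p`-monic simultaneous eigenvector labelled by `α`: `U_i f = ξ_i(α) f` for all `i`, and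
`f = p_α + ∑_{β ▷ α} A_{βα} p_β` with coefficients in `ℚ(κ)`. -/
def IsPMonicJack {N : ℕ} (α : Fin N → ℕ) (f : Poly N) : Prop :=
  (∀ i, opU i f = xi α i • f) ∧
    f - p α ∈ Submodule.span K (p '' {β : Fin N → ℕ | TriangleGT β α})

/-- The `p`-monic nonsymmetric Jack polynomial `ζ_α`: the polynomial `f` with `IsPMonicJack α f`. -/
noncomputable def zeta {N : ℕ} (α : Fin N → ℕ) : Poly N :=
  Classical.epsilon (IsPMonicJack α)

/-- `ℓ(α) = m`, that is, `m` is the largest index `j` with `α_j > 0`. -/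
def HasLength {N : ℕ} (α : Fin N → ℕ) (m : Fin N) : Prop :=
  IsGreatest {j : Fin N | 0 < α j} m

/-- `θ_m = (1,2)(2,3)⋯(m-1,m)`; the empty product if `m` is the first index. -/
def theta {N : ℕ} (m : Fin N) : Equiv.Perm (Fin N) :=
  (List.ofFn (fun k : Fin (m : ℕ) =>
    Equiv.swap (⟨k, k.2.trans m.2⟩ : Fin N) ⟨k + 1, lt_of_le_of_lt k.2 m.2⟩)).prod

/-- `α̃ = θ_m (α - ε(m)) = (α_m - 1, α_1, …, α_{m-1}, 0, …)`, used when `ℓ(α) = m`. -/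
def shift {N : ℕ} (m : Fin N) (α : Fin N → ℕ) : Fin N → ℕ :=
  compAct (theta m) (α - Pi.single m 1)

end NonsymJack

namespace NonsymJack

open MvPolynomial

variable {N : ℕ}

/-! The generating function F of the `p`-basis lets operators in x be traded for operators in y: x_i
D_i F equals y_i ∂F/∂y_i plus κ times divided differences of F in y (`xs_mul_dunklSeries`).
Comparing coefficients of y^α makes U_i triangular on the p_α, with diagonal entry ξ_i(α) and all
other terms strictly above α (`opU_p_sub_mem`). The U_i commute (`opU_comm`) and the tuples ξ(α) are
pairwise distinct (`xi_injective`), so triangular linear algebra yields exactly one joint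
eigenvector with leading term p_α (`exists_eigenvector`, `eigenvector_eq_zero`).

The formula for D_m ζ_α needs a sharper triangularity: every β that occurs also satisfies ℓ(β) ≤
ℓ(α) (`StrongGT`). A second identity (`dunklSeries_eq_ys_mul`) shows that y_i divides D_i F, so D_j
p_β = 0 whenever β_j = 0; hence D_j ζ_α = 0 for j > m. On polynomials killed by all these D_j, the
operator θ_m D_m intertwines U_i with U_{θ_m(i)}, up to a shift by 1 when i = m
(`opU_theta_dunkl_self`, `opU_theta_dunkl_of_ne`). The eigenvalues of α̃ differ from those of α in
just this way (`rank_shift`), so θ_m D_m ζ_α is a multiple of ζ_α̃ (`eigenvector_eq_smul`). The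
multiple is the coefficient of p_α̃, computed in `dunkl_p_sub_mem`; it is well defined because the
p_α are linearly independent, being monomials at κ = 0 (`linearIndependent_p`). -/

/-! ### Divided differences and Dunkl operators -/

theorem X_sub_X_ne_zero {i j : Fin N} (h : i ≠ j) : (X i - X j : Poly N) ≠ 0 := by
  intro h0
  exact h (X_injective (sub_eq_zero.1 h0))

/-- Cancellation of x_i - x_j pins down the chosen quotient, so each rule for divided differences
can be checked after clearing the denominator. -/
theorem divDiff_eq {i j : Fin N} (h : i ≠ j) {f g : Poly N}
    (hg : f - permAct (Equiv.swap i j) f = (X i - X j) * g) : divDiff i j f = g :=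
  mul_left_cancel₀ (X_sub_X_ne_zero h) ((divDiff_spec i j f).symm.trans hg)

@[simp] theorem permAct_add (w : Equiv.Perm (Fin N)) (f g : Poly N) :
    permAct w (f + g) = permAct w f + permAct w g := map_add (rename w) f g

@[simp] theorem permAct_sub (w : Equiv.Perm (Fin N)) (f g : Poly N) :
    permAct w (f - g) = permAct w f - permAct w g := map_sub (rename w) f g

@[simp] theorem permAct_mul (w : Equiv.Perm (Fin N)) (f g : Poly N) :
    permAct w (f * g) = permAct w f * permAct w g := map_mul (rename w) f g

@[simp] theorem permAct_smul (w : Equiv.Perm (Fin N)) (c : K) (f : Poly N) :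
    permAct w (c • f) = c • permAct w f := map_smul (rename w) c f

@[simp] theorem permAct_sum (w : Equiv.Perm (Fin N)) {ι : Type*} (s : Finset ι) (f : ι → Poly N) :
    permAct w (∑ a ∈ s, f a) = ∑ a ∈ s, permAct w (f a) := map_sum (rename w) f s

@[simp] theorem permAct_X (w : Equiv.Perm (Fin N)) (i : Fin N) :
    permAct w (X i : Poly N) = X (w i) := rename_X _ _

@[simp] theorem permAct_C (w : Equiv.Perm (Fin N)) (c : K) :
    permAct w (C c : Poly N) = C c := rename_C _ _

theorem permAct_permAct (w v : Equiv.Perm (Fin N)) (f : Poly N) :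
    permAct w (permAct v f) = permAct (w * v) f := by
  simp only [permAct, rename_rename]; rfl

@[simp] theorem permAct_one (f : Poly N) : permAct 1 f = f := by
  simp [permAct]

/-- `w (i j) = (w(i) w(j)) w`. -/
theorem permAct_swap_comm (w : Equiv.Perm (Fin N)) (i j : Fin N) (f : Poly N) :
    permAct w (permAct (Equiv.swap i j) f)
      = permAct (Equiv.swap (w i) (w j)) (permAct w f) := by
  rw [permAct_permAct, permAct_permAct, Equiv.mul_swap_eq_swap_mul]

theorem divDiff_add {i j : Fin N} (h : i ≠ j) (f g : Poly N) :
    divDiff i j (f + g) = divDiff i j f + divDiff i j g := by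
  apply divDiff_eq h
  rw [mul_add, ← divDiff_spec, ← divDiff_spec, permAct_add]
  ring

theorem divDiff_smul {i j : Fin N} (h : i ≠ j) (c : K) (f : Poly N) :
    divDiff i j (c • f) = c • divDiff i j f := by
  apply divDiff_eq h
  rw [mul_smul_comm, ← divDiff_spec, permAct_smul, smul_sub]

theorem divDiff_C {i j : Fin N} (h : i ≠ j) (c : K) : divDiff i j (C c : Poly N) = 0 := by
  apply divDiff_eq h
  simp

theorem permAct_divDiff (w : Equiv.Perm (Fin N)) {i j : Fin N} (h : i ≠ j) (f : Poly N) :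
    permAct w (divDiff i j f) = divDiff (w i) (w j) (permAct w f) := by
  symm
  apply divDiff_eq (w.injective.ne h)
  rw [← permAct_swap_comm, ← permAct_sub, divDiff_spec]
  simp

theorem divDiff_X_mul_left {i j : Fin N} (h : i ≠ j) (f : Poly N) :
    divDiff i j (X i * f) = X i * divDiff i j f + permAct (Equiv.swap i j) f := by
  apply divDiff_eq h
  have := divDiff_spec i j f
  rw [permAct_mul, permAct_X, Equiv.swap_apply_left]
  linear_combination X i * this

theorem divDiff_X_mul_right {i j : Fin N} (h : i ≠ j) (f : Poly N) :
    divDiff i j (X j * f) = X j * divDiff i j f - permAct (Equiv.swap i j) f := by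
  apply divDiff_eq h
  have := divDiff_spec i j f
  rw [permAct_mul, permAct_X, Equiv.swap_apply_right]
  linear_combination X j * this

theorem divDiff_X_mul_of_ne {i j k : Fin N} (h : i ≠ j) (hi : k ≠ i) (hj : k ≠ j) (f : Poly N) :
    divDiff i j (X k * f) = X k * divDiff i j f := by
  apply divDiff_eq h
  have := divDiff_spec i j f
  rw [permAct_mul, permAct_X, Equiv.swap_apply_of_ne_of_ne hi hj]
  linear_combination X k * this

theorem dunkl_add (i : Fin N) (f g : Poly N) : dunkl i (f + g) = dunkl i f + dunkl i g := by
  have : ∑ j ∈ Finset.univ.erase i, divDiff i j (f + g)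
      = ∑ j ∈ Finset.univ.erase i, divDiff i j f + ∑ j ∈ Finset.univ.erase i, divDiff i j g := by
    rw [← Finset.sum_add_distrib]
    exact Finset.sum_congr rfl fun j hj => divDiff_add (Finset.ne_of_mem_erase hj).symm f g
  simp only [dunkl, this, map_add, smul_add]
  abel

theorem dunkl_smul (i : Fin N) (c : K) (f : Poly N) : dunkl i (c • f) = c • dunkl i f := by
  have : ∑ j ∈ Finset.univ.erase i, divDiff i j (c • f)
      = c • ∑ j ∈ Finset.univ.erase i, divDiff i j f := by
    rw [Finset.smul_sum]
    exact Finset.sum_congr rfl fun j hj => divDiff_smul (Finset.ne_of_mem_erase hj).symm c f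
  simp only [dunkl, this, Derivation.map_smul, smul_add]
  rw [smul_comm]

/-- The Dunkl operator as a linear map. -/
noncomputable def dunklLin (i : Fin N) : Poly N →ₗ[K] Poly N where
  toFun := dunkl i
  map_add' := dunkl_add i
  map_smul' := dunkl_smul i

/-- The action of a permutation as a linear map. -/
noncomputable def permLin (w : Equiv.Perm (Fin N)) : Poly N →ₗ[K] Poly N :=
  (rename w).toLinearMap

theorem dunkl_sub (i : Fin N) (f g : Poly N) : dunkl i (f - g) = dunkl i f - dunkl i g :=
  map_sub (dunklLin i) f g

@[simp] theorem dunkl_zero (i : Fin N) : dunkl i (0 : Poly N) = 0 :=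
  map_zero (dunklLin i)

theorem dunkl_sum (i : Fin N) {ι : Type*} (s : Finset ι) (f : ι → Poly N) :
    dunkl i (∑ a ∈ s, f a) = ∑ a ∈ s, dunkl i (f a) :=
  map_sum (dunklLin i) f s

theorem dunkl_C (i : Fin N) (c : K) : dunkl i (C c : Poly N) = 0 := by
  have : ∑ j ∈ Finset.univ.erase i, divDiff i j (C c : Poly N) = 0 :=
    Finset.sum_eq_zero fun j hj => divDiff_C (Finset.ne_of_mem_erase hj).symm c
  simp [dunkl, this]

theorem permAct_pderiv (w : Equiv.Perm (Fin N)) (i : Fin N) (f : Poly N) :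
    permAct w (pderiv i f) = pderiv (w i) (permAct w f) :=
  (pderiv_rename w.injective i f).symm

/-- Equivariance of the Dunkl operators. -/
theorem permAct_dunkl (w : Equiv.Perm (Fin N)) (i : Fin N) (f : Poly N) :
    permAct w (dunkl i f) = dunkl (w i) (permAct w f) := by
  have : ∑ j ∈ Finset.univ.erase i, permAct w (divDiff i j f)
      = ∑ j ∈ Finset.univ.erase (w i), divDiff (w i) j (permAct w f) := by
    refine Finset.sum_equiv w (fun j => by simp) fun j hj => ?_
    exact permAct_divDiff w (Finset.ne_of_mem_erase hj).symm f
  simp only [dunkl, permAct_add, permAct_smul, permAct_sum, this, permAct_pderiv]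

theorem dunkl_X_mul_self (i : Fin N) (f : Poly N) :
    dunkl i (X i * f) = X i * dunkl i f + f
      + kappa • ∑ j ∈ Finset.univ.erase i, permAct (Equiv.swap i j) f := by
  have : ∑ j ∈ Finset.univ.erase i, divDiff i j (X i * f)
      = X i * ∑ j ∈ Finset.univ.erase i, divDiff i j f
        + ∑ j ∈ Finset.univ.erase i, permAct (Equiv.swap i j) f := by
    rw [Finset.mul_sum, ← Finset.sum_add_distrib]
    exact Finset.sum_congr rfl fun j hj => divDiff_X_mul_left (Finset.ne_of_mem_erase hj).symm f
  simp only [dunkl, this, Derivation.leibniz, pderiv_X_self, smul_eq_mul, smul_add, mul_add,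
    mul_one, mul_smul_comm]
  abel

theorem dunkl_X_mul_of_ne {i k : Fin N} (h : k ≠ i) (f : Poly N) :
    dunkl i (X k * f) = X k * dunkl i f - kappa • permAct (Equiv.swap i k) f := by
  have hk : k ∈ Finset.univ.erase i := by simp [h]
  have : ∑ j ∈ Finset.univ.erase i, divDiff i j (X k * f)
      = X k * ∑ j ∈ Finset.univ.erase i, divDiff i j f - permAct (Equiv.swap i k) f := by
    rw [← Finset.add_sum_erase _ _ hk, ← Finset.add_sum_erase _ (fun j => divDiff i j f) hk,
      divDiff_X_mul_right h.symm, mul_add, Finset.mul_sum]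
    rw [Finset.sum_congr rfl fun j hj => divDiff_X_mul_of_ne
      (Finset.ne_of_mem_erase (Finset.mem_of_mem_erase hj)).symm h
      (Finset.ne_of_mem_erase hj).symm f]
    ring
  simp only [dunkl, this, Derivation.leibniz, pderiv_X_of_ne h, smul_eq_mul, smul_sub, mul_add,
    mul_zero, mul_smul_comm]
  abel

theorem dunkl_swap {i j : Fin N} (f : Poly N) :
    dunkl i (permAct (Equiv.swap i j) f) = permAct (Equiv.swap i j) (dunkl j f) := by
  rw [permAct_dunkl, Equiv.swap_apply_right]

theorem dunkl_swap' {i j : Fin N} (f : Poly N) :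
    dunkl j (permAct (Equiv.swap i j) f) = permAct (Equiv.swap i j) (dunkl i f) := by
  rw [permAct_dunkl, Equiv.swap_apply_left]

theorem dunkl_swap_of_ne {i j k : Fin N} (hj : i ≠ j) (hk : i ≠ k) (f : Poly N) :
    dunkl i (permAct (Equiv.swap j k) f) = permAct (Equiv.swap j k) (dunkl i f) := by
  rw [permAct_dunkl, Equiv.swap_apply_of_ne_of_ne hj hk]

/-- This says that [D_i, D_j] commutes with x_i. Both sides reduce to D_j f + κ ∑_{k ≠ i,j} (i k)
D_j f, since the terms with (i j) cancel by equivariance. -/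
theorem dunkl_dunkl_X_mul {i j : Fin N} (h : i ≠ j) (f : Poly N) :
    dunkl i (dunkl j (X i * f)) - X i * dunkl i (dunkl j f)
      = dunkl j (dunkl i (X i * f)) - X i * dunkl j (dunkl i f) := by
  have hj : j ∈ Finset.univ.erase i := by simp [h.symm]
  have hs : ∑ k ∈ (Finset.univ.erase i).erase j, dunkl j (permAct (Equiv.swap i k) f)
      = ∑ k ∈ (Finset.univ.erase i).erase j, permAct (Equiv.swap i k) (dunkl j f) :=
    Finset.sum_congr rfl fun k hk =>
      dunkl_swap_of_ne h.symm (Finset.ne_of_mem_erase hk).symm f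
  rw [dunkl_X_mul_of_ne h, dunkl_X_mul_self, dunkl_sub, dunkl_add, dunkl_add, dunkl_smul,
    dunkl_smul, dunkl_X_mul_self, dunkl_X_mul_of_ne h, dunkl_sum,
    ← Finset.add_sum_erase _ _ hj, ← Finset.add_sum_erase _ _ hj, hs, dunkl_swap',
    Equiv.swap_comm j i, dunkl_swap']
  simp only [smul_add]
  abel

/-- The Dunkl operators commute. -/
theorem dunkl_comm (i j : Fin N) (f : Poly N) : dunkl i (dunkl j f) = dunkl j (dunkl i f) := by
  rcases eq_or_ne i j with rfl | h
  · rfl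
  induction f using MvPolynomial.induction_on with
  | C a => simp [dunkl_C]
  | add p q hp hq => simp only [dunkl_add, hp, hq]
  | mul_X p k hp =>
    rw [mul_comm]
    by_cases hi : k = i
    · subst hi
      have := dunkl_dunkl_X_mul h p
      rw [hp] at this
      exact sub_left_injective this
    by_cases hj : k = j
    · subst hj
      have := dunkl_dunkl_X_mul h.symm p
      rw [hp] at this
      exact (sub_left_injective this).symm
    -- For k different from i and j the corrections are -κ (i k) D_j p - κ (j k) D_i p, symmetric in
    -- i and j.
    rw [dunkl_X_mul_of_ne hi, dunkl_X_mul_of_ne hj, dunkl_sub, dunkl_sub, dunkl_smul, dunkl_smul,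
      dunkl_X_mul_of_ne hi, dunkl_X_mul_of_ne hj, hp, dunkl_swap_of_ne h (Ne.symm hi),
      dunkl_swap_of_ne h.symm (Ne.symm hj)]
    abel

/-! ### Commutativity of the operators U_i -/

/-- The operator `f ↦ D_i (x_i f)` as a linear map. -/
noncomputable def dunklX (i : Fin N) : Module.End K (Poly N) :=
  dunklLin i * LinearMap.mulLeft K (X i)

/-- The Jucys-Murphy sum `∑_{j < i} (j i)` as a linear map. -/
noncomputable def murphy (i : Fin N) : Module.End K (Poly N) :=
  ∑ j ∈ Finset.univ.filter (fun j => j < i), permLin (Equiv.swap j i)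

/-- The operator `U_i` as a linear map. -/
noncomputable def opULin (i : Fin N) : Module.End K (Poly N) :=
  dunklX i - kappa • murphy i

theorem dunklX_apply (i : Fin N) (f : Poly N) : dunklX i f = dunkl i (X i * f) := rfl

theorem murphy_apply (i : Fin N) (f : Poly N) :
    murphy i f = ∑ j ∈ Finset.univ.filter (fun j => j < i), permAct (Equiv.swap j i) f := by
  simp only [murphy, LinearMap.sum_apply]; rfl

theorem opULin_apply (i : Fin N) (f : Poly N) : opULin i f = opU i f := by
  simp only [opULin, LinearMap.sub_apply, LinearMap.smul_apply, murphy_apply, dunklX_apply, opU]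

theorem permAct_dunklX (w : Equiv.Perm (Fin N)) (i : Fin N) (f : Poly N) :
    permAct w (dunklX i f) = dunklX (w i) (permAct w f) := by
  simp [dunklX_apply, permAct_dunkl]

/-- Moving x_i past D_j gives D_i x_i D_j x_j = D_i D_j x_i x_j + κ D_i x_i (i j), whose first term
is symmetric in i and j. -/
theorem dunklX_comm_sub {i j : Fin N} (h : i ≠ j) (f : Poly N) :
    dunklX i (dunklX j f) - dunklX j (dunklX i f)
      = kappa • (dunklX i (permAct (Equiv.swap i j) f)
        - dunklX j (permAct (Equiv.swap i j) f)) := by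
  have key : ∀ {i j : Fin N}, i ≠ j → ∀ f : Poly N, dunklX i (dunklX j f)
      = dunkl i (dunkl j (X i * (X j * f))) + kappa • dunklX i (permAct (Equiv.swap i j) f) := by
    intro i j h f
    rw [dunklX_apply, dunklX_apply, dunklX_apply, dunkl_X_mul_of_ne h, dunkl_sub, dunkl_smul,
      permAct_mul, permAct_X, Equiv.swap_comm j i, Equiv.swap_apply_right]
    abel
  rw [key h, key h.symm, dunkl_comm i j, mul_left_comm (X i), Equiv.swap_comm j i, smul_sub]
  abel

theorem permAct_murphy {w : Equiv.Perm (Fin N)} {i : Fin N} (hi : w i = i)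
    (hw : ∀ j, j < i ↔ w j < i) (f : Poly N) :
    permAct w (murphy i f) = murphy i (permAct w f) := by
  simp only [murphy_apply, permAct_sum]
  refine Finset.sum_equiv w (fun j => by simpa using hw j) fun j _ => ?_
  rw [permAct_swap_comm, hi]

/-- For i < j the Murphy sums commute with each other, and D_j x_j commutes with the i-th one. The
j-th Murphy sum fails to commute with D_i x_i only through (i j), and this defect cancels the
commutator of D_i x_i and D_j x_j. -/
theorem opU_comm (i j : Fin N) (f : Poly N) :
    opULin i (opULin j f) = opULin j (opULin i f) := by
  wlog h : i < j generalizing i j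
  · rcases (not_lt.1 h).eq_or_lt with rfl | h'
    · rfl
    · exact (this j i h').symm
  have hij : i ∈ Finset.univ.filter (fun k => k < j) := by simp [h]
  have h1 : murphy j (murphy i f) = murphy i (murphy j f) := by
    rw [murphy_apply i, murphy_apply i, map_sum]
    refine Finset.sum_congr rfl fun k hk => ?_
    have hk : k < i := by simpa using hk
    rw [permAct_murphy (Equiv.swap_apply_of_ne_of_ne (hk.trans h).ne' h.ne')]
    intro l
    rw [Equiv.swap_apply_def]
    split_ifs <;> grind
  have h2 : dunklX j (murphy i f) = murphy i (dunklX j f) := by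
    rw [murphy_apply i, murphy_apply i, map_sum]
    refine Finset.sum_congr rfl fun k hk => ?_
    have hk : k < i := by simpa using hk
    rw [permAct_dunklX, Equiv.swap_apply_of_ne_of_ne (hk.trans h).ne' h.ne']
  have h3 : dunklX i (murphy j f) - murphy j (dunklX i f)
      = dunklX i (permAct (Equiv.swap i j) f) - dunklX j (permAct (Equiv.swap i j) f) := by
    rw [murphy_apply j, murphy_apply j, ← Finset.add_sum_erase _ _ hij,
      ← Finset.add_sum_erase _ _ hij, map_add, map_sum, permAct_dunklX, Equiv.swap_apply_left,
      Finset.sum_congr rfl fun k hk => ?_]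
    · abel
    · have h1 : k ≠ i := Finset.ne_of_mem_erase hk
      rw [permAct_dunklX, Equiv.swap_apply_of_ne_of_ne h1.symm h.ne]
  have h4 := dunklX_comm_sub h.ne f
  rw [← h3, smul_sub] at h4
  simp only [opULin, LinearMap.sub_apply, LinearMap.smul_apply, map_sub, map_smul, h1, h2]
  rw [sub_eq_iff_eq_add] at h4
  rw [h4]
  simp only [smul_sub]
  abel

/-! ### Power series in y and the factors (1 - x_i y_j)^{-t} -/

theorem coeff_X_mul_eq {σ R : Type*} [CommSemiring R] (j : σ) (d : σ →₀ ℕ)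
    (f : MvPowerSeries σ R) :
    MvPowerSeries.coeff d (MvPowerSeries.X j * f)
      = if d j = 0 then 0 else MvPowerSeries.coeff (d - Finsupp.single j 1) f := by
  classical
  rw [MvPowerSeries.X, MvPowerSeries.coeff_monomial_mul, one_mul]
  simp only [Finsupp.single_le_iff, Nat.one_le_iff_ne_zero, ite_not]

theorem coeff_euler {σ R : Type*} [CommSemiring R] (j : σ) (d : σ →₀ ℕ)
    (f : MvPowerSeries σ R) :
    MvPowerSeries.coeff d (MvPowerSeries.X j * MvPowerSeries.pderiv R j f)
      = (d j : R) * MvPowerSeries.coeff d f := by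
  rw [coeff_X_mul_eq]
  split_ifs with h
  · simp [h]
  · have h1 : d - Finsupp.single j 1 + Finsupp.single j 1 = d :=
      tsub_add_cancel_of_le (by simpa [Nat.one_le_iff_ne_zero] using h)
    rw [MvPowerSeries.coeff_pderiv, h1, mul_comm]
    congr 1
    have : d j = (d j - 1) + 1 := by omega
    rw [this]
    simp

/-- A derivation of the coefficient ring, acting on the coefficients of power series. -/
noncomputable def coeffDeriv {σ R k : Type*} [CommRing k] [CommRing R] [Algebra k R]
    (d : Derivation k R R) : Derivation k (MvPowerSeries σ R) (MvPowerSeries σ R) :=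
  Derivation.mk'
    { toFun := fun f n => d (MvPowerSeries.coeff n f)
      map_add' := fun f g => by
        ext n; exact (congrArg d (map_add _ f g)).trans (map_add d _ _)
      map_smul' := fun c f => by
        ext n
        exact d.map_smul c (MvPowerSeries.coeff n f) }
    (by
      classical
      intro f g
      ext n
      refine (congrArg d (MvPowerSeries.coeff_mul n f g)).trans ?_
      rw [map_sum, map_add, smul_eq_mul, smul_eq_mul, mul_comm g, MvPowerSeries.coeff_mul,
        MvPowerSeries.coeff_mul, ← Finset.sum_add_distrib]
      refine Finset.sum_congr rfl fun q _ => ?_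
      rw [d.leibniz, smul_eq_mul, smul_eq_mul, mul_comm (MvPowerSeries.coeff q.2 g)]
      rfl)

theorem coeff_coeffDeriv {σ R k : Type*} [CommRing k] [CommRing R] [Algebra k R]
    (d : Derivation k R R) (n : σ →₀ ℕ) (f : MvPowerSeries σ R) :
    MvPowerSeries.coeff n (coeffDeriv d f) = d (MvPowerSeries.coeff n f) := rfl

/-- Logarithmic derivative of a product, for an operator satisfying the Leibniz rule. -/
theorem leibniz_prod_eq {A ι : Type*} [CommRing A] {D : A → A} (h1 : D 1 = 0)
    (hD : ∀ f g, D (f * g) = f * D g + g * D f) (s : Finset ι) (f u : ι → A)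
    (h : ∀ a ∈ s, D (f a) = f a * u a) :
    D (∏ a ∈ s, f a) = (∏ a ∈ s, f a) * ∑ a ∈ s, u a := by
  classical
  induction s using Finset.induction_on with
  | empty => simp [h1]
  | insert a s ha ih =>
    rw [Finset.prod_insert ha, Finset.sum_insert ha, hD, h a (by simp),
      ih fun b hb => h b (by simp [hb])]
    ring

/-- Power series in `y` with coefficients polynomials in `x`. -/
abbrev PS (N : ℕ) : Type := MvPowerSeries (Fin N) (Poly N)

/-- The variable `x_i` as a power series in `y`. -/
noncomputable def xs (i : Fin N) : PS N := MvPowerSeries.C (X i)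

/-- The variable `y_i`. -/
noncomputable def ys (i : Fin N) : PS N := MvPowerSeries.X i

/-- A scalar as a power series. -/
noncomputable def cs (t : K) : PS N := MvPowerSeries.C (C t)

@[simp] theorem cs_one : (cs 1 : PS N) = 1 := by simp [cs]

theorem coeff_negPow_single (t : K) (i j : Fin N) (n : ℕ) :
    MvPowerSeries.coeff (Finsupp.single j n) (negPow t i j)
      = C ((ascPochhammer K n).eval t / (n.factorial : K)) * X i ^ n := by
  change negPow t i j (Finsupp.single j n) = _
  simp [negPow]

theorem coeff_negPow_of_ne (t : K) (i j : Fin N) {d : Fin N →₀ ℕ}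
    (h : d ≠ Finsupp.single j (d j)) : MvPowerSeries.coeff d (negPow t i j) = 0 := by
  change negPow t i j d = _
  rw [negPow, if_neg h]

theorem sub_single_ne {j : Fin N} {d : Fin N →₀ ℕ} (h : d ≠ Finsupp.single j (d j))
    (hj : d j ≠ 0) :
    d - Finsupp.single j 1 ≠ Finsupp.single j ((d - Finsupp.single j 1 : Fin N →₀ ℕ) j) := by
  intro h1
  apply h
  have h2 : d - Finsupp.single j 1 + Finsupp.single j 1 = d :=
    tsub_add_cancel_of_le (by simpa [Nat.one_le_iff_ne_zero] using hj)
  rw [h1, ← Finsupp.single_add] at h2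
  conv_lhs => rw [← h2]
  congr 1
  simp
  omega

/-- The geometric series. With this inverse at hand, later identities between rational expressions
in x and y become linear combinations of polynomial ones. -/
theorem negPow_one_mul (i j : Fin N) : negPow 1 i j * (1 - xs i * ys j) = 1 := by
  have h : negPow 1 i j = 1 + xs i * (ys j * negPow 1 i j) := by
    ext1 d
    rw [map_add, xs, MvPowerSeries.coeff_C_mul, ys, coeff_X_mul_eq]
    by_cases hd : d = Finsupp.single j (d j)
    · obtain ⟨n, rfl⟩ : ∃ n, d = Finsupp.single j n := ⟨_, hd⟩
      rcases n with _ | n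
      · rw [coeff_negPow_single]
        simp
      · have h1 : (Finsupp.single j (n + 1) : Fin N →₀ ℕ) ≠ 0 := by simp
        have h2 : (Finsupp.single j (n + 1) - Finsupp.single j 1 : Fin N →₀ ℕ)
          = Finsupp.single j n := by rw [← Finsupp.single_tsub]; simp
        have h3 : ∀ n : ℕ, (n.factorial : K) ≠ 0 := fun n => by
          exact_mod_cast n.factorial_ne_zero
        rw [h2, MvPowerSeries.coeff_one, if_neg h1, coeff_negPow_single, coeff_negPow_single,
          ascPochhammer_eval_one, ascPochhammer_eval_one, div_self (h3 _), div_self (h3 _)]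
        simp [pow_succ']
    · have h1 : d ≠ 0 := by rintro rfl; simp at hd
      rw [coeff_negPow_of_ne _ _ _ hd, MvPowerSeries.coeff_one, if_neg h1, zero_add]
      split_ifs with hj
      · simp
      · rw [coeff_negPow_of_ne _ _ _ (sub_single_ne hd hj), mul_zero]
  linear_combination h

theorem coeffDeriv_negPow_of_ne (t : K) {k i : Fin N} (h : i ≠ k) (j : Fin N) :
    coeffDeriv (pderiv k) (negPow t i j) = 0 := by
  ext1 d
  rw [coeff_coeffDeriv]
  by_cases hd : d = Finsupp.single j (d j)
  · rw [hd, coeff_negPow_single]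
    simp [pderiv_X_of_ne h]
  · simp [coeff_negPow_of_ne _ _ _ hd]

theorem coeffDeriv_negPow (t : K) (i j : Fin N) :
    coeffDeriv (pderiv i) (negPow t i j)
      = negPow t i j * (cs t * (ys j * negPow 1 i j)) := by
  -- The differential equation (1 - xy) g' = t y g, which on coefficients is (t)_{n+1} = (t + n)
  -- (t)_n.
  have h : coeffDeriv (pderiv i) (negPow t i j)
      = xs i * (ys j * coeffDeriv (pderiv i) (negPow t i j)) + cs t * (ys j * negPow t i j) := by
    ext1 d
    rw [map_add, xs, MvPowerSeries.coeff_C_mul, ys, coeff_X_mul_eq, cs, MvPowerSeries.coeff_C_mul,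
      coeff_X_mul_eq, coeff_coeffDeriv]
    by_cases hd : d = Finsupp.single j (d j)
    · obtain ⟨n, rfl⟩ : ∃ n, d = Finsupp.single j n := ⟨_, hd⟩
      rcases n with _ | n
      · rw [coeff_negPow_single]
        simp
      · have h2 : (Finsupp.single j (n + 1) - Finsupp.single j 1 : Fin N →₀ ℕ)
          = Finsupp.single j n := by rw [← Finsupp.single_tsub]; simp
        have h3 : ∀ n : ℕ, (n.factorial : K) ≠ 0 := fun n => by
          exact_mod_cast n.factorial_ne_zero
        have h4 : (ascPochhammer K (n + 1)).eval t / ((n + 1).factorial : K) * (n + 1 : K)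
            = (t + n) * ((ascPochhammer K n).eval t / (n.factorial : K)) := by
          rw [ascPochhammer_succ_eval, Nat.factorial_succ, Nat.cast_mul]
          have := h3 n
          have h5 : ((n + 1 : ℕ) : K) ≠ 0 := by exact_mod_cast n.succ_ne_zero
          push_cast at h5 ⊢
          field_simp
        have h5 := congrArg (C (σ := Fin N)) h4
        simp only [map_mul, map_add, map_one, map_natCast] at h5
        rw [h2, if_neg (by simp), if_neg (by simp), coeff_coeffDeriv, coeff_negPow_single,
          coeff_negPow_single]
        simp only [Derivation.leibniz, pderiv_C, Derivation.leibniz_pow,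
          pderiv_X_self, smul_eq_mul, mul_one, nsmul_eq_mul]
        push_cast
        rcases n with _ | n
        · simp at h5 ⊢
        · simp only [Nat.add_sub_cancel] at *
          push_cast at *
          linear_combination (X i) ^ (n + 1) * h5
    · rw [coeff_negPow_of_ne _ _ _ hd, map_zero]
      split_ifs with hj
      · simp
      · rw [coeff_coeffDeriv, coeff_negPow_of_ne _ _ _ (sub_single_ne hd hj), map_zero]
        simp
  have h1 := negPow_one_mul i j
  have h2 : coeffDeriv (pderiv i) (negPow t i j) * (1 - xs i * ys j)
     = cs t * (ys j * negPow t i j) := by linear_combination h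
  linear_combination (- coeffDeriv (pderiv i) (negPow t i j)) * h1 + negPow 1 i j * h2

theorem euler_negPow_of_ne (t : K) (i : Fin N) {j k : Fin N} (h : k ≠ j) :
    ys k * MvPowerSeries.pderiv (Poly N) k (negPow t i j) = 0 := by
  ext1 d
  rw [ys, coeff_euler]
  by_cases hd : d = Finsupp.single j (d j)
  · rw [hd]
    simp [Finsupp.single_eq_of_ne h]
  · simp [coeff_negPow_of_ne _ _ _ hd]

/-- The series depends only on the product x_i y_j, so y ∂/∂y and x ∂/∂x agree on it. -/
theorem euler_negPow (t : K) (i j : Fin N) :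
    ys j * MvPowerSeries.pderiv (Poly N) j (negPow t i j)
      = xs i * coeffDeriv (pderiv i) (negPow t i j) := by
  ext1 d
  rw [ys, coeff_euler, xs, MvPowerSeries.coeff_C_mul, coeff_coeffDeriv]
  by_cases hd : d = Finsupp.single j (d j)
  · obtain ⟨n, rfl⟩ : ∃ n, d = Finsupp.single j n := ⟨_, hd⟩
    rw [coeff_negPow_single]
    simp only [Derivation.leibniz, pderiv_C, Derivation.leibniz_pow,
      pderiv_X_self, smul_eq_mul, mul_one, nsmul_eq_mul, Finsupp.single_eq_same]
    rcases n with _ | n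
    · simp
    · simp only [Nat.add_sub_cancel]
      ring
  · simp [coeff_negPow_of_ne _ _ _ hd]

/-- The action of a permutation on the coefficients of a power series. -/
noncomputable def permSeries (w : Equiv.Perm (Fin N)) : PS N →+* PS N :=
  MvPowerSeries.map (rename w : Poly N →ₐ[K] Poly N).toRingHom

theorem coeff_permSeries (w : Equiv.Perm (Fin N)) (d : Fin N →₀ ℕ) (f : PS N) :
    MvPowerSeries.coeff d (permSeries w f) = permAct w (MvPowerSeries.coeff d f) := rfl

theorem permSeries_negPow (w : Equiv.Perm (Fin N)) (t : K) (i j : Fin N) :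
    permSeries w (negPow t i j) = negPow t (w i) j := by
  ext1 d
  rw [coeff_permSeries]
  by_cases hd : d = Finsupp.single j (d j)
  · rw [hd, coeff_negPow_single, coeff_negPow_single]
    simp [permAct]
  · rw [coeff_negPow_of_ne _ _ _ hd, coeff_negPow_of_ne _ _ _ hd]
    simp [permAct]

theorem rename_negPow (w : Equiv.Perm (Fin N)) (t : K) (i j : Fin N) :
    MvPowerSeries.rename w.toEmbedding (negPow t i j) = negPow t i (w j) := by
  ext1 d
  obtain ⟨d, rfl⟩ : ∃ e, d = Finsupp.embDomain w.toEmbedding e :=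
    ⟨Finsupp.embDomain w.symm.toEmbedding d, by
      ext a
      obtain ⟨b, rfl⟩ := w.surjective a
      rw [show w b = w.toEmbedding b from rfl, Finsupp.embDomain_apply_self]
      obtain ⟨c, rfl⟩ := w.symm.surjective b
      rw [show w.symm c = w.symm.toEmbedding c from rfl, Finsupp.embDomain_apply_self]
      simp⟩
  rw [MvPowerSeries.coeff_embDomain_rename]
  by_cases hd : d = Finsupp.single j (d j)
  · rw [hd, Finsupp.embDomain_single, coeff_negPow_single]
    exact (coeff_negPow_single _ _ _ _).symm
  · rw [coeff_negPow_of_ne _ _ _ hd, coeff_negPow_of_ne]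
    intro h
    apply hd
    rw [show w j = w.toEmbedding j from rfl, Finsupp.embDomain_apply_self,
      ← Finsupp.embDomain_single] at h
    exact Finsupp.embDomain_injective _ h

theorem pGen_eq : pGen N
    = (∏ i : Fin N, negPow 1 i i) * ∏ i : Fin N, ∏ j : Fin N, negPow kappa i j :=
  Finset.prod_mul_distrib

theorem permSeries_pGen (w : Equiv.Perm (Fin N)) :
    permSeries w (pGen N)
      = (∏ i : Fin N, negPow 1 (w i) i) * ∏ i : Fin N, ∏ j : Fin N, negPow kappa i j := by
  rw [pGen_eq, map_mul, map_prod, map_prod]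
  simp only [map_prod, permSeries_negPow]
  rw [Equiv.prod_comp w fun i => ∏ j : Fin N, negPow kappa i j]

/-- Permuting x and y simultaneously permutes the diagonal factors among themselves and preserves
the product over all pairs. -/
theorem rename_permSeries_pGen (w : Equiv.Perm (Fin N)) :
    MvPowerSeries.rename w.toEmbedding (permSeries w (pGen N)) = pGen N := by
  rw [permSeries_pGen, pGen_eq, map_mul, map_prod, map_prod]
  simp only [map_prod, rename_negPow]
  rw [Equiv.prod_comp w fun i => negPow 1 i i]
  congr 1
  exact Finset.prod_congr rfl fun i _ => Equiv.prod_comp w fun j => negPow kappa i j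

/-- `w p_α = p_{wα}`. -/
theorem permAct_p (w : Equiv.Perm (Fin N)) (α : Fin N → ℕ) :
    permAct w (p α) = p (compAct w α) := by
  have : Finsupp.equivFunOnFinite.symm (compAct w α)
      = Finsupp.embDomain w.toEmbedding (Finsupp.equivFunOnFinite.symm α) := by
    ext a
    obtain ⟨b, rfl⟩ := w.surjective a
    rw [show w b = w.toEmbedding b from rfl, Finsupp.embDomain_apply_self]
    simp [compAct]
  conv_rhs => rw [p, ← rename_permSeries_pGen w, this, MvPowerSeries.coeff_embDomain_rename]
  rfl

/-! ### Dunkl operators on the generating function -/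

theorem prod_eq_mul_mul_prod_erase {ι M : Type*} [Fintype ι] [DecidableEq ι] [CommMonoid M]
    {i k : ι} (h : i ≠ k) (f : ι → M) :
    ∏ x, f x = f i * (f k * ∏ x ∈ (Finset.univ.erase i).erase k, f x) := by
  rw [Finset.mul_prod_erase _ _ (by simp [h.symm]), Finset.mul_prod_erase _ _ (by simp)]

/-- The power series `F / ((1 - x_k y_i) (1 - x_i y_k))`, where `F` is the generating function. -/
noncomputable def pairSeries (i k : Fin N) : PS N := pGen N * (negPow 1 k i * negPow 1 i k)

theorem permSeries_swap_pGen {i k : Fin N} (h : i ≠ k) :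
    permSeries (Equiv.swap i k) (pGen N)
      = pairSeries i k * ((1 - xs i * ys i) * (1 - xs k * ys k)) := by
  have h1 : permSeries (Equiv.swap i k) (pGen N) * (negPow 1 i i * negPow 1 k k)
      = pGen N * (negPow 1 k i * negPow 1 i k) := by
    rw [permSeries_pGen, pGen_eq, prod_eq_mul_mul_prod_erase h,
      prod_eq_mul_mul_prod_erase h fun i => negPow (1 : K) i i, Equiv.swap_apply_left,
      Equiv.swap_apply_right, Finset.prod_congr rfl fun x hx => by
        rw [Equiv.swap_apply_of_ne_of_ne (Finset.ne_of_mem_erase (Finset.mem_of_mem_erase hx))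
          (Finset.ne_of_mem_erase hx)]]
    ring
  have h2 := negPow_one_mul i i
  have h3 := negPow_one_mul k k
  rw [pairSeries, ← h1]
  linear_combination (- permSeries (Equiv.swap i k) (pGen N)) * h2
    - permSeries (Equiv.swap i k) (pGen N) * negPow 1 i i * (1 - xs i * ys i) * h3

theorem pGen_eq_pairSeries (i k : Fin N) :
    pGen N = pairSeries i k * ((1 - xs k * ys i) * (1 - xs i * ys k)) := by
  have h2 := negPow_one_mul k i
  have h3 := negPow_one_mul i k
  rw [pairSeries]
  linear_combination (- pGen N) * h2 - pGen N * negPow 1 k i * (1 - xs k * ys i) * h3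

/-- The identity (1 - x_k y_i)(1 - x_i y_k) - (1 - x_i y_i)(1 - x_k y_k) = (x_i - x_k)(y_i - y_k).
Its symmetry between x and y lets a divided difference in x be read as one in y. -/
theorem pGen_sub_permSeries {i k : Fin N} (h : i ≠ k) :
    pGen N - permSeries (Equiv.swap i k) (pGen N)
      = (xs i - xs k) * ((ys i - ys k) * pairSeries i k) := by
  rw [permSeries_swap_pGen h]
  linear_combination pGen_eq_pairSeries i k

theorem divDiff_p {i k : Fin N} (h : i ≠ k) (α : Fin N → ℕ) :
    divDiff i k (p α) = MvPowerSeries.coeff (Finsupp.equivFunOnFinite.symm α)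
      ((ys i - ys k) * pairSeries i k) := by
  apply divDiff_eq h
  rw [p, ← coeff_permSeries, ← map_sub, pGen_sub_permSeries h, xs, xs, ← map_sub,
    MvPowerSeries.coeff_C_mul]

/-- The generating function of the polynomials `D_i p_α`. -/
noncomputable def dunklSeries (i : Fin N) : PS N :=
  coeffDeriv (pderiv i) (pGen N)
    + cs kappa * ∑ k ∈ Finset.univ.erase i, (ys i - ys k) * pairSeries i k

theorem dunkl_p_eq_coeff (i : Fin N) (α : Fin N → ℕ) :
    dunkl i (p α) = MvPowerSeries.coeff (Finsupp.equivFunOnFinite.symm α) (dunklSeries i) := by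
  rw [dunkl, dunklSeries, map_add, coeff_coeffDeriv, cs, MvPowerSeries.coeff_C_mul, map_sum,
    ← smul_eq_C_mul, ← p]
  congr 2
  exact Finset.sum_congr rfl fun k hk => divDiff_p (Finset.ne_of_mem_erase hk).symm α

theorem coeffDeriv_pGen (i : Fin N) :
    coeffDeriv (pderiv i) (pGen N)
      = pGen N * (ys i * negPow 1 i i + ∑ j, cs kappa * (ys j * negPow 1 i j)) := by
  have h0 : coeffDeriv (pderiv i) (1 : PS N) = 0 := Derivation.map_one_eq_zero _
  have hL : ∀ f g : PS N, coeffDeriv (pderiv i) (f * g)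
      = f * coeffDeriv (pderiv i) g + g * coeffDeriv (pderiv i) f := fun f g =>
    Derivation.leibniz _ f g
  have h : ∀ k : Fin N, coeffDeriv (pderiv i) (negPow 1 k k * ∏ j : Fin N, negPow kappa k j)
      = (negPow 1 k k * ∏ j : Fin N, negPow kappa k j) * (if k = i then
        (ys i * negPow 1 i i + ∑ j, cs kappa * (ys j * negPow 1 i j)) else 0) := by
    intro k
    split_ifs with hk
    · subst hk
      rw [hL, leibniz_prod_eq h0 hL _ _ _ fun j _ => coeffDeriv_negPow kappa k j,
        coeffDeriv_negPow, cs_one]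
      ring
    · rw [hL, leibniz_prod_eq h0 hL _ _ (fun _ => 0) fun j _ => by
        rw [coeffDeriv_negPow_of_ne _ hk, mul_zero], coeffDeriv_negPow_of_ne _ hk]
      simp
  rw [pGen, leibniz_prod_eq h0 hL _ _ _ fun k _ => h k]
  simp

theorem euler_pGen (i : Fin N) :
    ys i * MvPowerSeries.pderiv (Poly N) i (pGen N)
      = pGen N * (xs i * (ys i * negPow 1 i i)
        + ∑ k, cs kappa * (xs k * (ys i * negPow 1 k i))) := by
  set E : PS N → PS N := fun f => ys i * MvPowerSeries.pderiv (Poly N) i f with hE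
  have h0 : E 1 = 0 := by simp [hE]
  have hL : ∀ f g : PS N, E (f * g) = f * E g + g * E f := fun f g => by
    simp only [hE, Derivation.leibniz, smul_eq_mul]
    ring
  have h3 : ∀ (t : K) (k j : Fin N), E (negPow t k j)
      = negPow t k j * (if j = i then cs t * (xs k * (ys i * negPow 1 k i)) else 0) := by
    intro t k j
    split_ifs with hj
    · subst hj
      rw [hE]
      simp only [euler_negPow, coeffDeriv_negPow]
      ring
    · rw [hE]
      simp only [euler_negPow_of_ne _ _ (Ne.symm hj), mul_zero]
  have h4 : ∀ k : Fin N, E (negPow 1 k k * ∏ j : Fin N, negPow kappa k j)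
      = (negPow 1 k k * ∏ j : Fin N, negPow kappa k j) *
        ((if k = i then xs i * (ys i * negPow 1 i i) else 0)
          + cs kappa * (xs k * (ys i * negPow 1 k i))) := by
    intro k
    have h5 : (if k = i then cs 1 * (xs k * (ys i * negPow 1 k i)) else 0)
        = if k = i then xs i * (ys i * negPow 1 i i) else 0 := by
      split_ifs with hk
      · rw [hk, cs_one, one_mul]
      · rfl
    rw [hL, leibniz_prod_eq h0 hL _ _ _ fun j _ => h3 kappa k j, h3, h5]
    simp only [Finset.sum_ite_eq', Finset.mem_univ, if_true]
    ring
  have h6 := leibniz_prod_eq h0 hL Finset.univ _ _ fun k _ => h4 k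
  change E (pGen N) = _
  rw [pGen, h6]
  simp [Finset.sum_add_distrib]

theorem dunklSeries_eq (i : Fin N) :
    dunklSeries i = pGen N * (ys i * negPow 1 i i) + cs kappa * (pGen N * (ys i * negPow 1 i i))
      + cs kappa * ∑ k ∈ Finset.univ.erase i,
        (pGen N * (ys k * negPow 1 i k) + (ys i - ys k) * pairSeries i k) := by
  rw [dunklSeries, coeffDeriv_pGen, ← Finset.add_sum_erase _ _ (Finset.mem_univ i),
    Finset.sum_add_distrib]
  simp only [mul_add, Finset.mul_sum]
  simp only [mul_left_comm (cs kappa) (pGen N)]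
  abel

/-- Transfers x_i D_i from x to y: the logarithmic derivatives in x_i and y_i are matched term by
term, and each index k leaves a divided difference in y. -/
theorem xs_mul_dunklSeries (i : Fin N) :
    xs i * dunklSeries i = ys i * MvPowerSeries.pderiv (Poly N) i (pGen N)
      + cs kappa * ∑ k ∈ Finset.univ.erase i, ys i * ((xs i - xs k) * pairSeries i k) := by
  have h : ∀ k : Fin N, xs i * (pGen N * (ys k * negPow 1 i k) + (ys i - ys k) * pairSeries i k)
      = pGen N * (xs k * (ys i * negPow 1 k i)) + ys i * ((xs i - xs k) * pairSeries i k) := by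
    intro k
    have h1 := negPow_one_mul i k
    have h2 := negPow_one_mul k i
    rw [pairSeries]
    linear_combination pGen N * (xs k * ys i * negPow 1 k i * h1 - xs i * ys k * negPow 1 i k * h2)
  have h3 : xs i * ∑ k ∈ Finset.univ.erase i,
        (pGen N * (ys k * negPow 1 i k) + (ys i - ys k) * pairSeries i k)
      = ∑ k ∈ Finset.univ.erase i, pGen N * (xs k * (ys i * negPow 1 k i))
        + ∑ k ∈ Finset.univ.erase i, ys i * ((xs i - xs k) * pairSeries i k) := by
    rw [Finset.mul_sum, ← Finset.sum_add_distrib]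
    exact Finset.sum_congr rfl fun k _ => h k
  rw [dunklSeries_eq, euler_pGen, ← Finset.add_sum_erase _ _ (Finset.mem_univ i),
    ← Finset.mul_sum]
  rw [← Finset.mul_sum] at h3
  linear_combination cs kappa * h3

/-- In operator form, D_i F = y_i (D_i x_i F + κ F). Thus D_i p_α vanishes if α_i = 0, and otherwise
is (D_i x_i + κ) applied to p_{α - ε(i)}. -/
theorem dunklSeries_eq_ys_mul (i : Fin N) :
    dunklSeries i = ys i * (pGen N + cs kappa * pGen N
      + cs kappa * ∑ k ∈ Finset.univ.erase i, permSeries (Equiv.swap i k) (pGen N)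
      + xs i * dunklSeries i) := by
  -- The k-th summand times 1 - x_i y_i is y_i (i k)F.
  have h : ∀ k ∈ Finset.univ.erase i,
      pGen N * (ys k * negPow 1 i k) + (ys i - ys k) * pairSeries i k
      = ys i * permSeries (Equiv.swap i k) (pGen N) + ys i * (xs i *
        (pGen N * (ys k * negPow 1 i k) + (ys i - ys k) * pairSeries i k)) := by
    intro k hk
    have h1 := negPow_one_mul i k
    have h2 := negPow_one_mul k i
    rw [permSeries_swap_pGen (Finset.ne_of_mem_erase hk).symm, pairSeries]
    linear_combination (-pGen N) * ((1 - xs i * ys i) * ys k * negPow 1 i k) * h2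
  have h3 := Finset.sum_congr rfl h
  rw [Finset.sum_add_distrib (f := fun k => ys i * _), ← Finset.mul_sum, ← Finset.mul_sum,
    ← Finset.mul_sum] at h3
  have h4 := negPow_one_mul i i
  rw [dunklSeries_eq]
  linear_combination cs kappa * h3 + (1 + cs kappa) * pGen N * ys i * h4

/-! ### Dunkl operators on the polynomials p_α -/

/-- The coefficient of `y^α` in `y_i (F - (i k) F) / (y_i - y_k)`, where `F` is the generating
function and `(i k)` acts on the variables `y`. -/
noncomputable def spread (i k : Fin N) (α : Fin N → ℕ) : Poly N :=
  MvPowerSeries.coeff (Finsupp.equivFunOnFinite.symm α)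
    (ys i * ((xs i - xs k) * pairSeries i k))

theorem X_mul_dunkl_p (i : Fin N) (α : Fin N → ℕ) :
    X i * dunkl i (p α) = (α i : K) • p α + kappa • ∑ k ∈ Finset.univ.erase i, spread i k α := by
  have h := congrArg (MvPowerSeries.coeff (Finsupp.equivFunOnFinite.symm α))
    (xs_mul_dunklSeries i)
  rw [xs, MvPowerSeries.coeff_C_mul, ← dunkl_p_eq_coeff, map_add, ys, coeff_euler, cs,
    MvPowerSeries.coeff_C_mul, map_sum, ← smul_eq_C_mul, ← p] at h
  rw [h, smul_eq_C_mul (p α), map_natCast]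
  rfl

theorem dunkl_p_of_eq_zero {i : Fin N} {α : Fin N → ℕ} (h : α i = 0) : dunkl i (p α) = 0 := by
  rw [dunkl_p_eq_coeff, dunklSeries_eq_ys_mul, ys, coeff_X_mul_eq,
    if_pos (show Finsupp.equivFunOnFinite.symm α i = 0 from h)]

theorem equivFunOnFinite_symm_sub_single (α : Fin N → ℕ) (i : Fin N) :
    Finsupp.equivFunOnFinite.symm α - Finsupp.single i 1
      = Finsupp.equivFunOnFinite.symm (α - Pi.single i 1) := by
  ext a
  simp [Finsupp.single_apply, Pi.single_apply, eq_comm]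

theorem dunkl_p_of_ne_zero {i : Fin N} {α : Fin N → ℕ} (h : α i ≠ 0) :
    dunkl i (p α) = p (α - Pi.single i 1) + kappa • p (α - Pi.single i 1)
      + kappa • ∑ k ∈ Finset.univ.erase i, permAct (Equiv.swap i k) (p (α - Pi.single i 1))
      + X i * dunkl i (p (α - Pi.single i 1)) := by
  rw [dunkl_p_eq_coeff, dunklSeries_eq_ys_mul, ys, coeff_X_mul_eq, 
    if_neg (show ¬ Finsupp.equivFunOnFinite.symm α i = 0 from h),
    equivFunOnFinite_symm_sub_single, map_add, map_add, map_add, cs, MvPowerSeries.coeff_C_mul,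
    MvPowerSeries.coeff_C_mul, xs, MvPowerSeries.coeff_C_mul, ← dunkl_p_eq_coeff, map_sum,
    ← smul_eq_C_mul, ← smul_eq_C_mul]
  rfl

theorem spread_of_eq_zero {i : Fin N} (k : Fin N) {α : Fin N → ℕ} (h : α i = 0) :
    spread i k α = 0 := by
  rw [spread, ys, coeff_X_mul_eq,
    if_pos (show Finsupp.equivFunOnFinite.symm α i = 0 from h)]

theorem compAct_swap_update {i k : Fin N} (h : i ≠ k) (α : Fin N → ℕ) (a b : ℕ) :
    compAct (Equiv.swap i k) (Function.update (Function.update α i a) k b)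
      = Function.update (Function.update α i b) k a := by
  ext x
  simp only [compAct, Equiv.swap_inv]
  rw [Equiv.swap_apply_def]
  split_ifs with h1 h2
  · subst h1; simp [h]
  · subst h2; simp [h]
  · simp [h1, h2]

/-- With G the divided difference of F in y, compare coefficients in y_i G - y_k G = F - (i k)F;
this moves one unit of exponent between i and k. -/
theorem spread_update_succ {i k : Fin N} (h : i ≠ k) (α : Fin N → ℕ) (a b : ℕ) :
    spread i k (Function.update (Function.update α i (a + 1)) k b)
      = spread i k (Function.update (Function.update α i a) k (b + 1))
        - p (Function.update (Function.update α i a) k (b + 1))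
        + p (Function.update (Function.update α i (b + 1)) k a) := by
  have h1 : Function.update (Function.update α i (a + 1)) k b - Pi.single i 1
      = Function.update (Function.update α i a) k (b + 1) - Pi.single k 1 := by
    ext x
    by_cases hk : x = k
    · subst hk; simp [h.symm]
    · by_cases hi : x = i
      · subst hi; simp [h]
      · simp [hk, hi]
  have h2 : spread i k (Function.update (Function.update α i (a + 1)) k b)
      = MvPowerSeries.coeff (Finsupp.equivFunOnFinite.symm
          (Function.update (Function.update α i a) k (b + 1)))
          (ys k * ((xs i - xs k) * pairSeries i k)) := by
    rw [spread, ys, coeff_X_mul_eq, ys, coeff_X_mul_eq, if_neg (by simp [h]), if_neg (by simp),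
      equivFunOnFinite_symm_sub_single, equivFunOnFinite_symm_sub_single, h1]
  have h3 := congrArg (MvPowerSeries.coeff (Finsupp.equivFunOnFinite.symm
      (Function.update (Function.update α i a) k (b + 1)))) (pGen_sub_permSeries h)
  rw [map_sub, coeff_permSeries, ← p, permAct_p, compAct_swap_update h,
    show (xs i - xs k) * ((ys i - ys k) * pairSeries i k)
      = ys i * ((xs i - xs k) * pairSeries i k) - ys k * ((xs i - xs k) * pairSeries i k) by ring,
    map_sub, ← h2, ← spread] at h3
  linear_combination h3

/-- Unrolls the recursion down to a = 0, where the coefficient vanishes because of the factor y_i.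
All terms in the sum over c have their two entries further apart than a and b. -/
theorem spread_update {i k : Fin N} (h : i ≠ k) (α : Fin N → ℕ) (a b : ℕ) :
    spread i k (Function.update (Function.update α i a) k b)
      = (if b < a then p (Function.update (Function.update α i a) k b)
          - p (Function.update (Function.update α i b) k a) else 0)
        + ∑ c ∈ Finset.range (min a b),
          (p (Function.update (Function.update α i (a + b - c)) k c)
            - p (Function.update (Function.update α i c) k (a + b - c))) := by
  induction a generalizing b with
  | zero => rw [spread_of_eq_zero _ (by simp [h])]; simp
  | succ a ih =>
    rw [spread_update_succ h, ih, show a + 1 + b = a + (b + 1) by omega]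
    rcases lt_trichotomy a b with hab | rfl | hab
    · rw [if_neg (by omega), if_neg (by omega), show min a (b + 1) = a by omega,
        show min (a + 1) b = a + 1 by omega, Finset.sum_range_succ,
        show a + (b + 1) - a = b + 1 by omega]
      ring
    · rw [if_neg (by omega), if_pos (by omega), show min a (a + 1) = a by omega,
        show min (a + 1) a = a by omega]
      ring
    · rw [if_pos (show b < a + 1 by omega), show min a (b + 1) = b + 1 by omega,
        show min (a + 1) b = b by omega, Finset.sum_range_succ,
        show a + (b + 1) - b = a + 1 by omega]
      rcases eq_or_ne a (b + 1) with rfl | hne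
      · rw [if_neg (by omega)]
        ring
      · rw [if_pos (by omega)]
        ring

/-! ### The order on compositions -/

/-- `∑_i max (α_i - t, 0)`. -/
def excess (t : ℕ) (α : Fin N → ℕ) : ℕ := ∑ i, (α i - t)

theorem plus_antitone (α : Fin N → ℕ) : Antitone (plus α) := fun _ _ h =>
  Tuple.monotone_sort α (Fin.rev_le_rev.2 h)

theorem excess_plus (t : ℕ) (α : Fin N → ℕ) : excess t (plus α) = excess t α :=
  Equiv.sum_comp (Fin.revPerm.trans (Tuple.sort α)) fun i => α i - t

theorem plus_comp_perm (α : Fin N → ℕ) (σ : Equiv.Perm (Fin N)) : plus (α ∘ σ) = plus α := by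
  ext i
  exact congrFun (Tuple.comp_perm_comp_sort_eq_comp_sort (f := α) (σ := σ)) (Fin.rev i)

/-- The Hardy–Littlewood–Pólya test for dominance, which spares any computation with sorted
compositions. -/
theorem dominates_plus_of_excess {α β : Fin N → ℕ} (h : ∀ t, excess t α ≤ excess t β)
    (hlt : ∃ t, excess t α < excess t β) : Dominates (plus β) (plus α) := by
  refine ⟨fun he => ?_, fun j => ?_⟩
  · obtain ⟨t, ht⟩ := hlt
    rw [← excess_plus t α, ← excess_plus t β, he] at ht
    exact lt_irrefl _ ht
  -- At the j-th largest part of β the truncated difference is exact on the indices up to j, and the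
  -- excess of β has no contribution beyond j.
  · set t := plus β j
    have h1 : excess t (plus β) = ∑ i ∈ Finset.Iic j, (plus β i - t) := by
      refine (Finset.sum_subset (Finset.subset_univ _) fun i _ hi => ?_).symm
      have : j ≤ i := le_of_lt (by simpa using hi)
      exact Nat.sub_eq_zero_of_le (plus_antitone β this)
    have h2 : ∑ i ∈ Finset.Iic j, (plus α i - t) ≤ excess t (plus α) :=
      Finset.sum_le_sum_of_subset (Finset.subset_univ _)
    have h3 := h t
    rw [← excess_plus t α, ← excess_plus t β] at h3
    calc ∑ i ∈ Finset.Iic j, plus α i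
        ≤ ∑ i ∈ Finset.Iic j, (t + (plus α i - t)) :=
          Finset.sum_le_sum fun i _ => by omega
      _ = ∑ i ∈ Finset.Iic j, t + ∑ i ∈ Finset.Iic j, (plus α i - t) := Finset.sum_add_distrib
      _ ≤ ∑ i ∈ Finset.Iic j, t + ∑ i ∈ Finset.Iic j, (plus β i - t) := by omega
      _ = ∑ i ∈ Finset.Iic j, (t + (plus β i - t)) := Finset.sum_add_distrib.symm
      _ = ∑ i ∈ Finset.Iic j, plus β i := Finset.sum_congr rfl fun i hi => by
          have := plus_antitone β (Finset.mem_Iic.1 hi)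
          change plus β j ≤ plus β i at this
          omega

theorem eq_of_sum_Iic_eq {α β : Fin N → ℕ}
    (h : ∀ j : Fin N, ∑ i ∈ Finset.Iic j, α i = ∑ i ∈ Finset.Iic j, β i) : α = β := by
  ext j
  induction j using WellFoundedLT.induction with
  | ind j ih =>
    have h1 := h j
    rw [← Finset.Iio_insert, Finset.sum_insert (by simp), Finset.sum_insert (by simp),
      Finset.sum_congr rfl fun i hi => ih i (Finset.mem_Iio.1 hi)] at h1
    exact add_right_cancel h1

theorem Dominates.trans {α β γ : Fin N → ℕ} (h1 : Dominates α β) (h2 : Dominates β γ) :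
    Dominates α γ := by
  refine ⟨?_, fun j => (h2.2 j).trans (h1.2 j)⟩
  rintro rfl
  exact h1.1 (eq_of_sum_Iic_eq fun j => le_antisymm (h2.2 j) (h1.2 j))

theorem TriangleGT.irrefl (α : Fin N → ℕ) : ¬ TriangleGT α α := by
  rintro ⟨-, h | ⟨-, h⟩⟩ <;> exact h.1 rfl

theorem TriangleGT.trans {α β γ : Fin N → ℕ} (h1 : TriangleGT α β) (h2 : TriangleGT β γ) :
    TriangleGT α γ := by
  refine ⟨h1.1.trans h2.1, ?_⟩
  rcases h1.2 with h | ⟨e, h⟩ <;> rcases h2.2 with h' | ⟨e', h'⟩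
  · exact Or.inl (h.trans h')
  · exact Or.inl (e' ▸ h)
  · exact Or.inl (e ▸ h')
  · exact Or.inr ⟨e.trans e', h.trans h'⟩

theorem sum_eq_add_add_sum_erase {ι M : Type*} [Fintype ι] [DecidableEq ι] [AddCommMonoid M]
    {i k : ι} (h : i ≠ k) (f : ι → M) :
    ∑ x, f x = f i + (f k + ∑ x ∈ (Finset.univ.erase i).erase k, f x) := by
  rw [Finset.add_sum_erase _ _ (by simp [h.symm]), Finset.add_sum_erase _ _ (by simp)]

theorem sum_erase_erase_congr {i k : Fin N} {α β : Fin N → ℕ}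
    (h : ∀ x, x ≠ i → x ≠ k → β x = α x) (g : Fin N → ℕ → ℕ) :
    ∑ x ∈ (Finset.univ.erase i).erase k, g x (β x)
      = ∑ x ∈ (Finset.univ.erase i).erase k, g x (α x) :=
  Finset.sum_congr rfl fun x hx => by
    rw [h x (Finset.ne_of_mem_erase (Finset.mem_of_mem_erase hx)) (Finset.ne_of_mem_erase hx)]

/-- Spreading two entries apart moves a composition up. -/
theorem triangleGT_of_spread {i k : Fin N} (hik : i ≠ k) {α β : Fin N → ℕ}
    (h : ∀ x, x ≠ i → x ≠ k → β x = α x) (hs : β i + β k = α i + α k)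
    (hmin : min (β i) (β k) < min (α i) (α k)) : TriangleGT β α := by
  -- At t = min(α_i, α_k) the smaller old entry contributes nothing, while the larger new entry
  -- exceeds the larger old one.
  refine ⟨?_, Or.inl (dominates_plus_of_excess (fun t => ?_) ⟨min (α i) (α k), ?_⟩)⟩
  · have := sum_erase_erase_congr h fun _ n => n
    rw [sum_eq_add_add_sum_erase hik, sum_eq_add_add_sum_erase hik α]
    omega
  · have := sum_erase_erase_congr h fun _ n => n - t
    rw [excess, excess, sum_eq_add_add_sum_erase hik, sum_eq_add_add_sum_erase hik fun x => β x - t]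
    omega
  · have := sum_erase_erase_congr h fun _ n => n - min (α i) (α k)
    rw [excess, excess, sum_eq_add_add_sum_erase hik,
      sum_eq_add_add_sum_erase hik fun x => β x - min (α i) (α k)]
    omega

/-- Exchanging two entries so that the larger one comes first moves a composition up. -/
theorem triangleGT_of_swap {i k : Fin N} (hik : i < k) {α β : Fin N → ℕ}
    (h : ∀ x, x ≠ i → x ≠ k → β x = α x) (hi : β i = α k) (hk : β k = α i)
    (hlt : α i < α k) : TriangleGT β α := by
  have hβ : β = α ∘ Equiv.swap i k := by
    ext x
    rw [Function.comp_apply, Equiv.swap_apply_def]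
    split_ifs with h1 h2
    · rw [h1, hi]
    · rw [h2, hk]
    · exact h x h1 h2
  refine ⟨?_, Or.inr ⟨hβ ▸ plus_comp_perm _ _, ?_, fun j => ?_⟩⟩
  · rw [hβ]
    exact Equiv.sum_comp (Equiv.swap i k) α
  · intro he
    rw [he] at hi
    omega
  · have h1 := sum_erase_erase_congr h fun x n => if x ≤ j then n else 0
    have h2 : ∀ γ : Fin N → ℕ, ∑ x ∈ Finset.Iic j, γ x = ∑ x, if x ≤ j then γ x else 0 := by
      intro γ
      rw [← Finset.sum_filter]
      congr 1
      ext; simp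
    rw [h2, h2, sum_eq_add_add_sum_erase hik.ne,
      sum_eq_add_add_sum_erase hik.ne fun x => if x ≤ j then β x else 0]
    split_ifs with h3 h4 h4
    · omega
    · omega
    · exact absurd (hik.le.trans h4) h3
    · omega

/-- The relation `β ▷ α`, together with `ℓ(β) ≤ ℓ(α)`. -/
def StrongGT (β α : Fin N → ℕ) : Prop :=
  TriangleGT β α ∧ ∀ j, (∀ k, j ≤ k → α k = 0) → β j = 0

theorem StrongGT.trans {α β γ : Fin N → ℕ} (h1 : StrongGT α β) (h2 : StrongGT β γ) :
    StrongGT α γ :=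
  ⟨h1.1.trans h2.1, fun j hj => h1.2 j fun k hk => h2.2 k fun l hl => hj l (hk.trans hl)⟩

theorem strongGT_of_spread {i k : Fin N} (hik : i ≠ k) {α β : Fin N → ℕ}
    (h : ∀ x, x ≠ i → x ≠ k → β x = α x) (hs : β i + β k = α i + α k)
    (hmin : min (β i) (β k) < min (α i) (α k)) : StrongGT β α := by
  refine ⟨triangleGT_of_spread hik h hs hmin, fun j hj => ?_⟩
  rw [h j, hj j le_rfl]
  · rintro rfl
    have := hj j le_rfl
    omega
  · rintro rfl
    have := hj j le_rfl
    omega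

theorem strongGT_of_swap {i k : Fin N} (hik : i < k) {α β : Fin N → ℕ}
    (h : ∀ x, x ≠ i → x ≠ k → β x = α x) (hi : β i = α k) (hk : β k = α i)
    (hlt : α i < α k) : StrongGT β α := by
  refine ⟨triangleGT_of_swap hik h hi hk hlt, fun j hj => ?_⟩
  rw [h j, hj j le_rfl]
  · rintro rfl
    have := hj k hik.le
    omega
  · rintro rfl
    have := hj j le_rfl
    omega

/-- The compositions of a given size form a finite set. -/
theorem finite_sum_eq (n : ℕ) : {α : Fin N → ℕ | ∑ i, α i = n}.Finite := by
  refine (Fintype.piFinset fun _ : Fin N => Finset.range (n + 1)).finite_toSet.subset ?_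
  intro α hα
  simp only [Finset.mem_coe, Fintype.mem_piFinset, Finset.mem_range]
  intro i
  have : α i ≤ ∑ i, α i := Finset.single_le_sum (fun _ _ => Nat.zero_le _) (Finset.mem_univ i)
  have hα : ∑ i, α i = n := hα
  omega

theorem update_ne_ne {i k : Fin N} (α : Fin N → ℕ) (a b : ℕ) (x : Fin N) (hi : x ≠ i)
    (hk : x ≠ k) : Function.update (Function.update α i a) k b x = α x := by
  simp [hi, hk]

theorem compAct_swap_eq_update {i k : Fin N} (h : i ≠ k) (α : Fin N → ℕ) :
    compAct (Equiv.swap i k) α = Function.update (Function.update α i (α k)) k (α i) := by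
  conv_lhs => rw [← Function.update_eq_self i α,
    ← Function.update_eq_self k (Function.update _ _ _)]
  rw [Function.update_of_ne h.symm]
  exact compAct_swap_update h _ _ _

/-! ### Triangularity of U_i and leading term of D_m -/

/-- The expansion of `spread i k α` in the polynomials `p_β`. -/
theorem spread_sub_mem {i k : Fin N} (h : i ≠ k) (α : Fin N → ℕ) {S : Submodule K (Poly N)}
    (hS : ∀ u v, u + v = α i + α k → min u v < min (α i) (α k) →
      p (Function.update (Function.update α i u) k v) ∈ S) :
    spread i k α - (if α k < α i then p α - p (compAct (Equiv.swap i k) α) else 0) ∈ S := by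
  have h1 := spread_update h α (α i) (α k)
  rw [← compAct_swap_eq_update h] at h1
  have h2 : Function.update (Function.update α i (α i)) k (α k) = α := by simp
  rw [h2] at h1
  rw [h1, add_sub_cancel_left]
  refine Submodule.sum_mem _ fun c hc => Submodule.sub_mem _ (hS _ _ ?_ ?_) (hS _ _ ?_ ?_) <;>
  · have := Finset.mem_range.1 hc
    omega

/-- Expresses N - r(α,i) as the number of k whose term in U_i p_α returns p_α, which is where the
κ-part of ξ_i comes from. -/
theorem rank_add_card (α : Fin N → ℕ) (i : Fin N) :
    rank α i + ((Finset.univ.erase i).filter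
      (fun k => α k < α i ∨ (i < k ∧ α k = α i))).card = N := by
  rw [rank, ← Finset.card_union_of_disjoint, ← Finset.card_union_of_disjoint]
  · refine Eq.trans ?_ (Finset.card_fin N)
    congr 1
    ext k
    simp
    grind
  · rw [Finset.disjoint_left]
    intro k
    simp
    grind
  · rw [Finset.disjoint_left]
    intro k
    simp
    grind

theorem xi_eq (α : Fin N → ℕ) (i : Fin N) :
    xi α i = (α i + 1 : K) + kappa * ((Finset.univ.erase i).filter
      (fun k => α k < α i ∨ (i < k ∧ α k = α i))).card := by
  have h : (N : K) = _ := congrArg (Nat.cast (R := K)) (rank_add_card α i).symm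
  rw [xi, h]
  push_cast
  ring

/-- Triangularity of `U_i` on the polynomials `p_α`. -/
theorem opU_p_sub_mem (i : Fin N) (α : Fin N → ℕ) :
    opU i (p α) - xi α i • p α ∈ Submodule.span K (p '' {β | StrongGT β α}) := by
  set S := Submodule.span K (p '' {β : Fin N → ℕ | StrongGT β α})
  have hS : ∀ β, StrongGT β α → p β ∈ S := fun β hβ => Submodule.subset_span ⟨β, hβ, rfl⟩
  -- Subtracting the Murphy sum leaves only the transpositions (i k) with k > i, so U_i splits into
  -- one contribution per k.
  have hterm : ∀ k ∈ Finset.univ.erase i, spread i k α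
      + (if i < k then permAct (Equiv.swap i k) (p α) else 0)
      - (if α k < α i ∨ (i < k ∧ α k = α i) then p α else 0) ∈ S := by
    intro k hk
    have hki : k ≠ i := Finset.ne_of_mem_erase hk
    have h1 : spread i k α - (if α k < α i then p α - p (compAct (Equiv.swap i k) α) else 0)
        ∈ S := by
      refine spread_sub_mem hki.symm α fun u v hs hm => hS _ ?_
      refine strongGT_of_spread hki.symm (update_ne_ne α u v) ?_ ?_ <;>
        simpa [hki.symm] using by omega
    have h2 : ∀ x, x ≠ i → x ≠ k → compAct (Equiv.swap i k) α x = α x := fun x hi hk => by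
      rw [compAct_swap_eq_update hki.symm, update_ne_ne α _ _ x hi hk]
    have h3 : compAct (Equiv.swap i k) α i = α k := by simp [compAct]
    have h4 : compAct (Equiv.swap i k) α k = α i := by simp [compAct]
    rw [permAct_p]
    rcases lt_trichotomy (α k) (α i) with hlt | heq | hgt
    · rw [if_pos hlt] at h1
      rw [if_pos (Or.inl hlt)]
      -- If k < i, the exchanged composition has its larger entry earlier and so lies above α; if k
      -- > i, it cancels against the surviving transposition.
      rcases lt_or_gt_of_ne hki with hlt' | hgt'
      · rw [if_neg hlt'.not_gt]
        have h5 := hS _ (strongGT_of_swap hlt' (fun x hk hi => h2 x hi hk) h4 h3 hlt)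
        convert S.sub_mem h1 h5 using 1
        abel
      · rw [if_pos hgt']
        convert h1 using 1
        abel
    · have h5 : compAct (Equiv.swap i k) α = α := by
        rw [compAct_swap_eq_update hki.symm, heq]
        nth_rw 2 [← heq]
        simp
      rw [if_neg heq.not_lt, sub_zero] at h1
      simpa [heq, h5] using h1
    · rw [if_neg hgt.not_gt, sub_zero] at h1
      rw [if_neg (show ¬ (α k < α i ∨ (i < k ∧ α k = α i)) by omega), sub_zero]
      refine S.add_mem h1 ?_
      split_ifs with hik
      · exact hS _ (strongGT_of_swap hik h2 h3 h4 hgt)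
      · exact S.zero_mem
  have hU : opU i (p α) = (α i + 1 : K) • p α + kappa • ∑ k ∈ Finset.univ.erase i,
      (spread i k α + (if i < k then permAct (Equiv.swap i k) (p α) else 0)) := by
    have h1 : ∑ k ∈ Finset.univ.erase i, permAct (Equiv.swap i k) (p α)
        = ∑ k ∈ Finset.univ.erase i, (if i < k then permAct (Equiv.swap i k) (p α) else 0)
          + ∑ k ∈ Finset.univ.filter (fun k => k < i), permAct (Equiv.swap k i) (p α) := by
      rw [← Finset.sum_filter, ← Finset.sum_filter_add_sum_filter_not _ fun k => i < k]
      congr 1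
      refine Finset.sum_congr ?_ fun k _ => by rw [Equiv.swap_comm]
      ext k
      simp
      omega
    rw [opU, dunkl_X_mul_self, X_mul_dunkl_p, h1, Finset.sum_add_distrib]
    simp only [add_smul, one_smul, smul_add]
    abel
  have hsum := S.smul_mem kappa (Submodule.sum_mem S hterm)
  rw [Finset.sum_sub_distrib, ← Finset.sum_filter, Finset.sum_const] at hsum
  convert hsum using 1
  rw [hU, xi_eq]
  simp only [add_smul, smul_sub, mul_smul, Nat.cast_smul_eq_nsmul]
  abel

/-- Leading term of `D_m p_α` when `α` vanishes beyond `m`. -/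
theorem dunkl_p_sub_mem {m : Fin N} {α : Fin N → ℕ} (hm : α m ≠ 0) (hα : ∀ j, m < j → α j = 0) :
    dunkl m (p α) - (((N : K) + 1 - (rank α m : K)) * kappa + (α m : K)) • p (α - Pi.single m 1)
      ∈ Submodule.span K (p '' {γ | TriangleGT (γ + Pi.single m 1) α}) := by
  set S := Submodule.span K (p '' {γ : Fin N → ℕ | TriangleGT (γ + Pi.single m 1) α})
  have hS : ∀ γ, TriangleGT (γ + Pi.single m 1) α → p γ ∈ S :=
    fun γ h => Submodule.subset_span ⟨γ, h, rfl⟩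
  set γ := α - Pi.single m 1 with hγ
  have hγm : γ m = α m - 1 := by simp [hγ]
  have hγk : ∀ k, k ≠ m → γ k = α k := fun k hk => by simp [hγ, hk]
  have hupd : ∀ k u v, k ≠ m → Function.update (Function.update γ m u) k v + Pi.single m 1
      = Function.update (Function.update α m (u + 1)) k v := by
    intro k u v hk
    ext x
    by_cases h1 : x = k
    · subst h1; simp [hk]
    · by_cases h2 : x = m
      · subst h2; simp [h1]
      · simp [h1, h2, hγk]
  have hterm : ∀ k ∈ Finset.univ.erase m, spread m k γ + permAct (Equiv.swap m k) (p γ)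
      - (if α k < α m ∨ (m < k ∧ α k = α m) then p γ else 0) ∈ S := by
    intro k hk
    have hkm : k ≠ m := Finset.ne_of_mem_erase hk
    have h0 : ¬ (m < k ∧ α k = α m) := fun h => hm (h.2 ▸ hα k h.1)
    have h1 : spread m k γ - (if γ k < γ m then p γ - p (compAct (Equiv.swap m k) γ) else 0)
        ∈ S := by
      refine spread_sub_mem hkm.symm γ fun u v hs hmin => hS _ ?_
      rw [hupd k u v hkm]
      rw [hγm, hγk k hkm] at hs hmin
      by_cases h : min (u + 1) v < min (α m) (α k)
      · refine triangleGT_of_spread hkm.symm (update_ne_ne α _ _) ?_ ?_ <;>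
          simpa [hkm.symm] using by omega
      -- What remains is u = α_k - 1, v = α_m with 0 < α_k < α_m: after restoring ε(m), the entries
      -- k and m of α are exchanged.
      · have hlt : k < m := by
          rcases lt_or_gt_of_ne hkm with h2 | h2
          · exact h2
          · have := hα k h2
            omega
        refine triangleGT_of_swap hlt (fun x hx hx' => update_ne_ne α _ _ x hx' hx) ?_ ?_ ?_
        · simp; omega
        · simp [hkm.symm]; omega
        · omega
    rw [permAct_p]
    rw [hγm, hγk k hkm] at h1
    rcases lt_trichotomy (α k) (α m - 1) with hlt | heq | hgt
    · rw [if_pos hlt] at h1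
      rw [if_pos (Or.inl (by omega))]
      convert h1 using 1
      abel
    · have h5 : compAct (Equiv.swap m k) γ = γ := by
        rw [compAct_swap_eq_update hkm.symm, hγk k hkm, heq, ← hγm, Function.update_eq_self, hγm,
          ← heq, ← hγk k hkm, Function.update_eq_self]
      rw [if_neg heq.not_lt, sub_zero] at h1
      rw [if_pos (Or.inl (by omega)), h5]
      simpa using h1
    · rw [if_neg hgt.not_gt, sub_zero] at h1
      rw [if_neg (show ¬ (α k < α m ∨ (m < k ∧ α k = α m)) by omega), sub_zero]
      -- Here α_k ≥ α_m, and restoring ε(m) gives the entries α_k + 1 and α_m - 1, which are further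
      -- apart.
      refine S.add_mem h1 (hS _ ?_)
      rw [compAct_swap_eq_update hkm.symm, hupd _ _ _ hkm, hγm, hγk k hkm]
      refine triangleGT_of_spread hkm.symm (update_ne_ne α _ _) ?_ ?_ <;>
          simpa [hkm.symm] using by omega
  have hsum := S.smul_mem kappa (Submodule.sum_mem S hterm)
  rw [Finset.sum_sub_distrib, ← Finset.sum_filter, Finset.sum_const] at hsum
  have hc : ((N : K) + 1 - (rank α m : K)) * kappa + (α m : K)
      = 1 + (γ m : K) + kappa + kappa * ((Finset.univ.erase m).filter
      (fun k => α k < α m ∨ (m < k ∧ α k = α m))).card := by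
    have h : (N : K) = _ := congrArg (Nat.cast (R := K)) (rank_add_card α m).symm
    have h' : (α m : K) = γ m + 1 := by
      rw [hγm]
      exact_mod_cast (by omega : α m = α m - 1 + 1)
    rw [h, h']
    push_cast
    ring
  convert hsum using 1
  rw [hc, dunkl_p_of_ne_zero hm, X_mul_dunkl_p]
  simp only [add_smul, smul_sub, mul_smul, Nat.cast_smul_eq_nsmul, Finset.sum_add_distrib,
    smul_add, one_smul]
  abel

/-! ### Joint eigenvectors of commuting triangular operators -/

section Triangular

variable {k V ι A : Type*} [Field k] [AddCommGroup V] [Module k V]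

/-- A finite set of labels that is closed under passing to larger labels is built up by adding one
label at a time, the largest labels first. -/
theorem upper_induction {R : A → A → Prop} (hirr : ∀ a, ¬ R a a)
    (htr : ∀ a b c, R a b → R b c → R a c) {P : Set A → Prop} (h0 : P ∅)
    (hins : ∀ (S : Set A) (a : A), (∀ b ∈ S, ∀ c, R c b → c ∈ S) → (∀ c, R c a → c ∈ S) →
      a ∉ S → P S → P (insert a S)) :
    ∀ S : Set A, S.Finite → (∀ b ∈ S, ∀ c, R c b → c ∈ S) → P S := by
  classical
  suffices h : ∀ (n : ℕ) (S : Finset A), S.card = n → (∀ b ∈ S, ∀ c, R c b → c ∈ S) → P S by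
    intro S hS hup
    have := h _ hS.toFinset rfl (by simpa using hup)
    simpa using this
  intro n
  induction n with
  | zero =>
    intro S hS _
    rw [Finset.card_eq_zero.1 hS]
    simpa using h0
  | succ n ih =>
    intro S hS hup
    -- A label with the most labels above it has none below it, by transitivity and irreflexivity.
    obtain ⟨a, ha, hmax⟩ := S.exists_max_image (fun b => (S.filter fun c => R c b).card)
      (Finset.card_pos.1 (by omega))
    have hmin : ∀ b ∈ S, ¬ R a b := by
      intro b hb hab
      refine absurd (hmax b hb) (not_le.2 (Finset.card_lt_card ⟨?_, fun hsub => ?_⟩))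
      · intro c hc
        rw [Finset.mem_filter] at hc ⊢
        exact ⟨hc.1, htr _ _ _ hc.2 hab⟩
      · exact hirr a (Finset.mem_filter.1 (hsub (Finset.mem_filter.2 ⟨ha, hab⟩))).2
    have hup' : ∀ b ∈ S.erase a, ∀ c, R c b → c ∈ S.erase a := by
      intro b hb c hcb
      refine Finset.mem_erase.2 ⟨?_, hup b (Finset.mem_of_mem_erase hb) c hcb⟩
      rintro rfl
      exact hmin b (Finset.mem_of_mem_erase hb) hcb
    have h := hins (S.erase a : Finset A) a hup' (fun c hc => Finset.mem_coe.2
      (Finset.mem_erase.2 ⟨fun h => hirr a (h ▸ hc), hup a ha c hc⟩)) (by simp)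
      (ih _ (by rw [Finset.card_erase_of_mem ha, hS]; rfl) hup')
    rwa [← Finset.coe_insert, Finset.insert_erase ha] at h

variable {U : ι → Module.End k V} {v : A → V} {ξ : A → ι → k} {R : A → A → Prop}

theorem map_span_insert
    (htri : ∀ a i, U i (v a) - ξ a i • v a ∈ Submodule.span k (v '' {b | R b a}))
    {S : Set A} {a : A} (hS : ∀ b ∈ S, ∀ c, R c b → c ∈ S) (ha : ∀ c, R c a → c ∈ S) (i : ι)
    {x : V} (hx : x ∈ Submodule.span k (v '' insert a S)) :
    U i x - ξ a i • x ∈ Submodule.span k (v '' S) := by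
  have hle : Submodule.span k (v '' insert a S)
      ≤ (Submodule.span k (v '' S)).comap (U i - ξ a i • LinearMap.id) := by
    rw [Submodule.span_le]
    rintro _ ⟨b, rfl | hb, rfl⟩
    · exact Submodule.span_mono (Set.image_mono ha) (htri b i)
    · have h1 : U i (v b) - ξ b i • v b ∈ Submodule.span k (v '' S) :=
        Submodule.span_mono (Set.image_mono fun c hc => hS b hb c hc) (htri b i)
      have h2 : v b ∈ Submodule.span k (v '' S) := Submodule.subset_span ⟨b, hb, rfl⟩
      have h3 := Submodule.add_mem _ h1 (Submodule.smul_mem _ (ξ b i - ξ a i) h2)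
      change U i (v b) - ξ a i • v b ∈ Submodule.span k (v '' S)
      convert h3 using 1
      rw [sub_smul]
      abel
  exact hle hx

/-- Choose i with ξ_i(a) ≠ ξ_i(a₀). Then U_i - ξ_i(a) pushes x into the smaller span, yet it only
multiplies x by a nonzero scalar. -/
theorem mem_span_of_mem_span_insert
    (htri : ∀ a i, U i (v a) - ξ a i • v a ∈ Submodule.span k (v '' {b | R b a}))
    (hξ : Function.Injective ξ) {S : Set A} {a a₀ : A} (hS : ∀ b ∈ S, ∀ c, R c b → c ∈ S)
    (ha : ∀ c, R c a → c ∈ S) (hne : a ≠ a₀) {x : V} (hx : x ∈ Submodule.span k (v '' insert a S))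
    (hU : ∀ i, U i x = ξ a₀ i • x) : x ∈ Submodule.span k (v '' S) := by
  obtain ⟨i, hi⟩ := Function.ne_iff.1 (hξ.ne hne.symm)
  have h := map_span_insert htri hS ha i hx
  rw [hU, ← sub_smul] at h
  exact (Submodule.smul_mem_iff _ (sub_ne_zero.2 hi)).1 h

theorem eigenvector_eq_zero (hirr : ∀ a, ¬ R a a) (htr : ∀ a b c, R a b → R b c → R a c)
    (htri : ∀ a i, U i (v a) - ξ a i • v a ∈ Submodule.span k (v '' {b | R b a}))
    (hξ : Function.Injective ξ) {S : Set A} (hfin : S.Finite) (hS : ∀ b ∈ S, ∀ c, R c b → c ∈ S)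
    {a₀ : A} (ha₀ : a₀ ∉ S) {x : V} (hx : x ∈ Submodule.span k (v '' S))
    (hU : ∀ i, U i x = ξ a₀ i • x) : x = 0 := by
  revert ha₀ hx
  refine upper_induction hirr htr (P := fun S => a₀ ∉ S → x ∈ Submodule.span k (v '' S) → x = 0)
    ?_ ?_ S hfin hS
  · intro _ hx
    simpa using hx
  · intro S a hS ha _ ih ha₀ hx
    exact ih (fun h => ha₀ (Or.inr h))
      (mem_span_of_mem_span_insert htri hξ hS ha (fun h => ha₀ (Or.inl h.symm)) hx hU)

/-- Labels other than a₀ are stripped off one at a time. Once a₀ is reached, subtracting a multiple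
of z leaves an eigenvector supported away from a₀, which vanishes. -/
theorem eigenvector_eq_smul (hirr : ∀ a, ¬ R a a) (htr : ∀ a b c, R a b → R b c → R a c)
    (htri : ∀ a i, U i (v a) - ξ a i • v a ∈ Submodule.span k (v '' {b | R b a}))
    (hξ : Function.Injective ξ) {S : Set A} (hfin : S.Finite) (hS : ∀ b ∈ S, ∀ c, R c b → c ∈ S)
    {a₀ : A} {x z : V} (hx : x ∈ Submodule.span k (v '' S)) (hU : ∀ i, U i x = ξ a₀ i • x)
    (hz : z - v a₀ ∈ Submodule.span k (v '' {b | R b a₀})) (hUz : ∀ i, U i z = ξ a₀ i • z) :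
    ∃ c : k, x = c • z := by
  revert hx
  refine upper_induction hirr htr
    (P := fun S => S.Finite → x ∈ Submodule.span k (v '' S) → ∃ c : k, x = c • z)
    ?_ ?_ S hfin hS hfin
  · intro _ hx
    exact ⟨0, by simpa using hx⟩
  · intro S a hS ha haS ih hfin hx
    by_cases hne : a = a₀
    · subst hne
      rw [Set.image_insert_eq, Submodule.mem_span_insert] at hx
      obtain ⟨c, s, hs, hxs⟩ := hx
      refine ⟨c, sub_eq_zero.1 (eigenvector_eq_zero hirr htr htri hξ
        (hfin.subset (Set.subset_insert _ _)) hS haS (x := x - c • z) ?_ fun i => ?_)⟩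
      · have h := Submodule.smul_mem _ c (Submodule.span_mono (Set.image_mono ha) hz)
        convert Submodule.sub_mem _ hs h using 1
        rw [hxs, smul_sub]
        abel
      · rw [map_sub, map_smul, hU, hUz, smul_sub, smul_comm]
    · exact ih (hfin.subset (Set.subset_insert _ _))
        (mem_span_of_mem_span_insert htri hξ hS ha hne hx hU)

/-- The eigenvector is the image of v_{a₀} under a product of factors (U_i - ξ_i(a)) / (ξ_i(a₀) -
ξ_i(a)), one for each a above a₀. Commutativity ensures that a factor improves the error for every
U_j at once. -/
theorem exists_eigenvector (hirr : ∀ a, ¬ R a a) (htr : ∀ a b c, R a b → R b c → R a c)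
    (hcomm : ∀ i j x, U i (U j x) = U j (U i x))
    (htri : ∀ a i, U i (v a) - ξ a i • v a ∈ Submodule.span k (v '' {b | R b a}))
    (hξ : Function.Injective ξ) (a₀ : A) (hfin : {b | R b a₀}.Finite) :
    ∃ z, z - v a₀ ∈ Submodule.span k (v '' {b | R b a₀}) ∧ ∀ i, U i z = ξ a₀ i • z := by
  suffices h : ∀ x, (∀ j, U j x - ξ a₀ j • x ∈ Submodule.span k (v '' {b | R b a₀})) →
      ∃ z, z - x ∈ Submodule.span k (v '' {b | R b a₀}) ∧ ∀ i, U i z = ξ a₀ i • z from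
    h _ (htri a₀)
  refine upper_induction hirr htr (P := fun S => a₀ ∉ S → ∀ x,
      (∀ j, U j x - ξ a₀ j • x ∈ Submodule.span k (v '' S)) →
      ∃ z, z - x ∈ Submodule.span k (v '' S) ∧ ∀ i, U i z = ξ a₀ i • z)
    ?_ ?_ {b | R b a₀} hfin (fun b hb c hc => htr _ _ _ hc hb) (hirr a₀)
  · intro _ x hx
    exact ⟨x, by simp, fun i => sub_eq_zero.1 (by simpa using hx i)⟩
  · intro S a hS ha haS ih ha₀ x hx
    obtain ⟨i, hi⟩ := Function.ne_iff.1 (hξ.ne fun h : a₀ = a => ha₀ (Or.inl h))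
    have hc : ξ a₀ i - ξ a i ≠ 0 := sub_ne_zero.2 hi
    obtain ⟨z, hz, hUz⟩ := ih (fun h => ha₀ (Or.inr h))
      ((ξ a₀ i - ξ a i)⁻¹ • (U i x - ξ a i • x)) fun j => by
        have h := Submodule.smul_mem _ (ξ a₀ i - ξ a i)⁻¹ (map_span_insert htri hS ha i (hx j))
        convert h using 1
        rw [map_smul, map_sub, map_sub, map_smul, map_smul, hcomm j i, smul_comm (ξ a₀ j),
          ← smul_sub]
        congr 1
        rw [smul_sub, smul_sub, smul_comm (ξ a₀ j)]
        abel
    refine ⟨z, ?_, hUz⟩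
    have h1 := Submodule.span_mono (Set.image_mono (Set.subset_insert a S)) hz
    have h2 := Submodule.smul_mem _ (ξ a₀ i - ξ a i)⁻¹ (hx i)
    convert Submodule.add_mem _ h1 h2 using 1
    have h3 : x = (ξ a₀ i - ξ a i)⁻¹ • ((ξ a₀ i - ξ a i) • x) := by
      rw [smul_smul, inv_mul_cancel₀ hc, one_smul]
    conv_lhs => rw [h3]
    rw [← sub_eq_zero]
    have : ∀ (c : k) (A B C D : V), A - c • B - (A - c • C + c • D) = c • (C - B - D) := by
      intro c A B C D
      simp only [smul_sub]
      abel
    rw [this, sub_smul]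
    simp

end Triangular

/-! ### Linear independence of the p_α -/

/-- Linear independence over `ℚ(κ)` can be checked at `κ = 0`. -/
theorem linearIndependent_of_eval_zero {ι σ : Type*} (P : ι → MvPolynomial σ (Polynomial ℚ))
    (h : LinearIndependent ℚ fun a => map (Polynomial.evalRingHom (0 : ℚ)) (P a)) :
    LinearIndependent K fun a => map (algebraMap (Polynomial ℚ) K) (P a) := by
  rw [← LinearIndependent.iff_fractionRing (R := Polynomial ℚ)]
  -- Evaluating a relation at κ = 0 shows that κ divides all its coefficients. Dividing it out and
  -- repeating, every power of κ divides them, so they vanish.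
  have key : ∀ (n : ℕ) (s : Finset ι) (c : ι → Polynomial ℚ), ∑ a ∈ s, c a • P a = 0 →
      ∀ a ∈ s, Polynomial.X ^ n ∣ c a := by
    intro n
    induction n with
    | zero => intro s c _ a _; simp
    | succ n ih =>
      intro s c hc
      have h1 : ∀ a ∈ s, (c a).eval 0 = 0 := by
        refine linearIndependent_iff'.1 h s (fun a => (c a).eval 0) ?_
        have := congrArg (map (Polynomial.evalRingHom (0 : ℚ))) hc
        simpa [smul_eq_C_mul] using this
      have h2 : ∀ a ∈ s, c a = Polynomial.X * (c a).divX := by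
        intro a ha
        have := Polynomial.X_mul_divX_add (c a)
        rw [Polynomial.coeff_zero_eq_eval_zero, h1 a ha] at this
        simpa using this.symm
      have h3 : ∑ a ∈ s, (c a).divX • P a = 0 := by
        have h4 : (C Polynomial.X : MvPolynomial σ (Polynomial ℚ))
            * ∑ a ∈ s, (c a).divX • P a = 0 := by
          rw [← hc, Finset.mul_sum]
          refine Finset.sum_congr rfl fun a ha => ?_
          conv_rhs => rw [h2 a ha]
          rw [← smul_eq_C_mul, smul_smul]
        refine (mul_eq_zero.1 h4).resolve_left ?_
        exact fun h => Polynomial.X_ne_zero (C_eq_zero.1 h)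
      intro a ha
      rw [h2 a ha, pow_succ']
      exact mul_dvd_mul_left _ (ih s _ h3 a ha)
  rw [linearIndependent_iff']
  intro s c hc a ha
  have h1 : ∑ a ∈ s, c a • P a = 0 := by
    apply map_injective (algebraMap (Polynomial ℚ) K) (IsFractionRing.injective _ _)
    rw [map_zero, map_sum, ← hc]
    refine Finset.sum_congr rfl fun a _ => ?_
    rw [smul_eq_C_mul, map_mul, map_C, ← algebraMap_smul K (c a), smul_eq_C_mul]
  by_contra hne
  have h2 := Polynomial.natDegree_le_of_dvd (key ((c a).natDegree + 1) s c h1 a ha) hne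
  rw [Polynomial.natDegree_X_pow] at h2
  omega

/-- The series `(1 - x_i y_j)^{-t}` with a polynomial exponent `t ∈ ℚ[κ]`. -/
noncomputable def negPowInt (t : Polynomial ℚ) (i j : Fin N) :
    MvPowerSeries (Fin N) (MvPolynomial (Fin N) (Polynomial ℚ)) :=
  fun d => if d = Finsupp.single j (d j) then
    C ((ascPochhammer (Polynomial ℚ) (d j)).eval t * Polynomial.C ((d j).factorial : ℚ)⁻¹)
      * X i ^ (d j) else 0

/-- The generating function of the `p`-basis over `ℚ[κ]`. -/
noncomputable def pGenInt (N : ℕ) :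
    MvPowerSeries (Fin N) (MvPolynomial (Fin N) (Polynomial ℚ)) :=
  ∏ i : Fin N, (negPowInt 1 i i * ∏ j : Fin N, negPowInt Polynomial.X i j)

/-- The polynomial `p_α` over `ℚ[κ]`. -/
noncomputable def pInt (α : Fin N → ℕ) : MvPolynomial (Fin N) (Polynomial ℚ) :=
  MvPowerSeries.coeff (Finsupp.equivFunOnFinite.symm α) (pGenInt N)

theorem map_ascPochhammer_eval {R S : Type*} [CommRing R] [CommRing S] (f : R →+* S) (n : ℕ)
    (t : R) : f ((ascPochhammer R n).eval t) = (ascPochhammer S n).eval (f t) := by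
  rw [← ascPochhammer_map f, Polynomial.eval_map, Polynomial.eval₂_hom]

theorem map_negPowInt (t : Polynomial ℚ) (i j : Fin N) :
    MvPowerSeries.map (map (algebraMap (Polynomial ℚ) K)) (negPowInt t i j)
      = negPow (algebraMap (Polynomial ℚ) K t) i j := by
  ext1 d
  change map (algebraMap (Polynomial ℚ) K) (negPowInt t i j d) = negPow _ i j d
  rw [negPowInt, negPow]
  split_ifs
  · rw [map_mul, map_C, map_pow, map_X, map_mul, map_ascPochhammer_eval, div_eq_mul_inv]
    congr 3
    have h : ((d j).factorial : K) ≠ 0 := by exact_mod_cast (d j).factorial_ne_zero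
    refine eq_inv_of_mul_eq_one_left ?_
    rw [← map_natCast (algebraMap (Polynomial ℚ) K), ← map_mul, ← map_natCast Polynomial.C,
      ← map_mul, inv_mul_cancel₀ (by exact_mod_cast (d j).factorial_ne_zero), map_one, map_one]
  · simp

theorem map_pInt (α : Fin N → ℕ) : map (algebraMap (Polynomial ℚ) K) (pInt α) = p α := by
  have h : MvPowerSeries.map (map (algebraMap (Polynomial ℚ) K)) (pGenInt N) = pGen N := by
    simp only [pGenInt, pGen, map_prod, map_mul, map_negPowInt, map_one]
    rfl
  rw [p, ← h]
  rfl

theorem map_eval_zero_negPowInt_X (i j : Fin N) :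
    MvPowerSeries.map (map (Polynomial.evalRingHom (0 : ℚ))) (negPowInt Polynomial.X i j) = 1 := by
  ext1 d
  change map (Polynomial.evalRingHom (0 : ℚ)) (negPowInt Polynomial.X i j d) = _
  rw [negPowInt, MvPowerSeries.coeff_one]
  by_cases hd : d = 0
  · subst hd
    simp
  · rw [if_neg hd]
    split_ifs with h
    · have hj : d j ≠ 0 := fun h0 => hd (by rw [h, h0, Finsupp.single_zero])
      rw [map_mul, map_C, map_mul, map_ascPochhammer_eval]
      simp [hj]
    · simp

/-- The coefficient of a product of power series, the `i`-th one in the variable `y_i` only. -/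
theorem coeff_prod_of_single {σ R : Type*} [Fintype σ] [CommSemiring R]
    (f : σ → MvPowerSeries σ R)
    (hf : ∀ i d, d ≠ Finsupp.single i (d i) → MvPowerSeries.coeff d (f i) = 0) (d : σ →₀ ℕ) :
    MvPowerSeries.coeff d (∏ i, f i)
      = ∏ i, MvPowerSeries.coeff (Finsupp.single i (d i)) (f i) := by
  classical
  rw [MvPowerSeries.coeff_prod]
  set l₀ : σ →₀ (σ →₀ ℕ) := Finsupp.equivFunOnFinite.symm fun i => Finsupp.single i (d i)
  have h0 : ∀ i, l₀ i = Finsupp.single i (d i) := fun i => rfl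
  rw [Finset.sum_eq_single l₀]
  · rfl
  · intro l hl hne
    rw [Finset.mem_finsuppAntidiag] at hl
    by_cases h : ∀ i, l i = Finsupp.single i (l i i)
    · refine absurd (Finsupp.ext fun i => ?_) hne
      rw [h0, h i]
      congr 1
      rw [← hl.1, Finsupp.finsetSum_apply, Finset.sum_eq_single i]
      · intro j _ hj
        rw [h j, Finsupp.single_eq_of_ne hj.symm]
      · simp
    · push Not at h
      obtain ⟨i, hi⟩ := h
      exact Finset.prod_eq_zero (Finset.mem_univ i) (hf i _ hi)
  · intro h
    refine absurd (Finset.mem_finsuppAntidiag.2 ⟨?_, Finset.subset_univ _⟩) h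
    simp only [h0]
    exact Finsupp.univ_sum_single d

/-- At κ = 0 only ∏ (1 - x_i y_i)^{-1} is left of the generating function. -/
theorem eval_zero_pInt (α : Fin N → ℕ) :
    map (Polynomial.evalRingHom (0 : ℚ)) (pInt α)
      = monomial (Finsupp.equivFunOnFinite.symm α) 1 := by
  set φ := MvPowerSeries.map (σ := Fin N)
    (map (σ := Fin N) (Polynomial.evalRingHom (0 : ℚ))) with hφ
  have h1 : φ (pGenInt N) = ∏ i : Fin N, φ (negPowInt 1 i i) := by
    simp only [pGenInt, map_prod, map_mul, hφ, map_eval_zero_negPowInt_X, Finset.prod_const_one,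
      mul_one]
  have h2 : ∀ (i : Fin N) (d : Fin N →₀ ℕ), MvPowerSeries.coeff d (φ (negPowInt 1 i i))
      = map (Polynomial.evalRingHom (0 : ℚ)) (negPowInt 1 i i d) := fun _ _ => rfl
  have h3 : map (Polynomial.evalRingHom (0 : ℚ)) (pInt α)
      = MvPowerSeries.coeff (Finsupp.equivFunOnFinite.symm α) (φ (pGenInt N)) := rfl
  rw [h3, h1, coeff_prod_of_single]
  · have h4 : ∀ i : Fin N, MvPowerSeries.coeff (Finsupp.single i (α i)) (φ (negPowInt 1 i i))
        = X i ^ α i := by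
      intro i
      have h5 : ((α i).factorial : ℚ) ≠ 0 := by exact_mod_cast (α i).factorial_ne_zero
      rw [h2, negPowInt, if_pos (by simp), map_mul, map_C, map_mul, map_ascPochhammer_eval]
      simp [ascPochhammer_eval_one, h5]
    rw [monomial_eq, C_1, one_mul, Finsupp.prod_fintype _ _ fun i => pow_zero _]
    exact Finset.prod_congr rfl fun i _ => h4 i
  · intro i d hd
    rw [h2, negPowInt, if_neg hd, map_zero]

theorem linearIndependent_p : LinearIndependent K (p : (Fin N → ℕ) → Poly N) := by
  have h := linearIndependent_of_eval_zero (pInt : (Fin N → ℕ) → _) (by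
    simp only [eval_zero_pInt]
    have h1 := (MvPolynomial.basisMonomials (Fin N) ℚ).linearIndependent
    rw [MvPolynomial.coe_basisMonomials] at h1
    exact h1.comp _ Finsupp.equivFunOnFinite.symm.injective)
  simpa only [map_pInt] using h

/-! ### Existence and uniqueness of ζ_α -/

/-- The constant term of ξ_i(α) in κ is α_i + 1. -/
theorem xi_injective : Function.Injective (xi : (Fin N → ℕ) → Fin N → K) := by
  intro α β h
  ext i
  have key : ∀ γ : Fin N → ℕ, xi γ i = algebraMap (Polynomial ℚ) K
      (Polynomial.C ((N : ℚ) - rank γ i) * Polynomial.X + Polynomial.C ((γ i : ℚ) + 1)) := by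
    intro γ
    rw [xi, kappa]
    simp
    ring
  have h1 := congrFun h i
  rw [key, key] at h1
  have h2 := congrArg (fun q : Polynomial ℚ => q.coeff 0)
    (IsFractionRing.injective (Polynomial ℚ) K h1)
  simpa using h2

theorem opU_p_sub_mem_triangleGT (α : Fin N → ℕ) (i : Fin N) :
    opULin i (p α) - xi α i • p α ∈ Submodule.span K (p '' {β | TriangleGT β α}) := by
  rw [opULin_apply]
  exact Submodule.span_mono (Set.image_mono fun _ h => h.1) (opU_p_sub_mem i α)

theorem finite_triangleGT (α : Fin N → ℕ) : {β | TriangleGT β α}.Finite :=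
  (finite_sum_eq (∑ i, α i)).subset fun _ h => h.1

theorem exists_jack (α : Fin N → ℕ) : ∃ f : Poly N, (∀ i, opU i f = xi α i • f) ∧
    f - p α ∈ Submodule.span K (p '' {β | StrongGT β α}) := by
  obtain ⟨f, hf, hU⟩ := exists_eigenvector (U := opULin) (v := p) (ξ := xi) (R := StrongGT)
    (fun a h => TriangleGT.irrefl a h.1) (fun _ _ _ => StrongGT.trans) opU_comm
    (fun a i => by rw [opULin_apply]; exact opU_p_sub_mem i a) xi_injective α
    ((finite_triangleGT α).subset fun _ h => h.1)
  exact ⟨f, fun i => by rw [← opULin_apply]; exact hU i, hf⟩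

theorem IsPMonicJack.eq {α : Fin N → ℕ} {f g : Poly N} (hf : IsPMonicJack α f)
    (hg : IsPMonicJack α g) : f = g := by
  refine sub_eq_zero.1 (eigenvector_eq_zero (U := opULin) (v := p) (ξ := xi) (R := TriangleGT)
    TriangleGT.irrefl (fun _ _ _ => TriangleGT.trans) opU_p_sub_mem_triangleGT xi_injective
    (finite_triangleGT α) (fun b hb c hc => hc.trans hb) (TriangleGT.irrefl α) ?_ fun i => ?_)
  · convert Submodule.sub_mem _ hf.2 hg.2 using 1
    abel
  · rw [map_sub, opULin_apply, opULin_apply, hf.1, hg.1, smul_sub]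

theorem existsUnique_jack (α : Fin N → ℕ) : ∃! f : Poly N, IsPMonicJack α f := by
  obtain ⟨f, hU, hf⟩ := exists_jack α
  have : IsPMonicJack α f := ⟨hU, Submodule.span_mono (Set.image_mono fun _ h => h.1) hf⟩
  exact ⟨f, this, fun g hg => hg.eq this⟩

theorem isPMonicJack_zeta (α : Fin N → ℕ) : IsPMonicJack α (zeta α) :=
  Classical.epsilon_spec (existsUnique_jack α).exists

/-- The eigenvector built with the finer order also qualifies for the coarser one, so uniqueness
there gives ζ_α the support bound. -/
theorem zeta_sub_mem (α : Fin N → ℕ) :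
    zeta α - p α ∈ Submodule.span K (p '' {β | StrongGT β α}) := by
  obtain ⟨f, hU, hf⟩ := exists_jack α
  have : IsPMonicJack α f := ⟨hU, Submodule.span_mono (Set.image_mono fun _ h => h.1) hf⟩
  rwa [(isPMonicJack_zeta α).eq this]

/-! ### Intertwining by θ_m D_m -/

theorem theta_succ {n : ℕ} (h : n + 1 < N) :
    theta (⟨n + 1, h⟩ : Fin N)
      = theta ⟨n, by omega⟩ * Equiv.swap ⟨n, by omega⟩ ⟨n + 1, h⟩ := by
  simp only [theta]
  rw [List.ofFn_succ', List.concat_eq_append, List.prod_append, List.prod_singleton]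
  rfl

theorem theta_apply (m x : Fin N) :
    (theta m x : ℕ) = if x < m then (x : ℕ) + 1 else if x = m then 0 else x := by
  obtain ⟨n, hn⟩ := m
  induction n generalizing x with
  | zero =>
    have : theta (⟨0, hn⟩ : Fin N) = 1 := rfl
    rw [this]
    simp only [Fin.lt_def, Fin.ext_iff, Equiv.Perm.one_apply]
    split_ifs <;> omega
  | succ n ih =>
    rw [theta_succ, Equiv.Perm.mul_apply, ih, Equiv.swap_apply_def]
    simp only [Fin.lt_def, Fin.ext_iff]
    split_ifs <;> simp_all <;> omega

/-- The cycle brings m to the front and keeps the order of all other indices; this governs how the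
Murphy sums change under conjugation. -/
theorem theta_lt_theta {m l i : Fin N} :
    theta m l < theta m i ↔ (l = m ∧ i ≠ m) ∨ (l ≠ m ∧ i ≠ m ∧ l < i) := by
  rw [Fin.lt_def, theta_apply, theta_apply]
  simp only [Fin.lt_def, Fin.ext_iff, Ne]
  split_ifs <;> omega

theorem opU_permAct (w : Equiv.Perm (Fin N)) (i : Fin N) (f : Poly N) :
    opU (w i) (permAct w f) = permAct w (dunklX i f
      - kappa • ∑ l ∈ Finset.univ.filter (fun l => w l < w i), permAct (Equiv.swap l i) f) := by
  rw [permAct_sub, permAct_smul, permAct_sum, permAct_dunklX, opU, dunklX_apply]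
  congr 2
  refine (Finset.sum_equiv w (fun l => by simp) fun l _ => ?_).symm
  exact permAct_swap_comm w l i f

theorem dunklX_dunkl_of_ne {i m : Fin N} (h : i ≠ m) (f : Poly N) :
    dunklX i (dunkl m f)
      = dunkl m (dunklX i f) + kappa • permAct (Equiv.swap i m) (dunkl m f) := by
  rw [dunklX_apply, dunklX_apply, dunkl_comm m i, dunkl_X_mul_of_ne h, dunkl_sub, dunkl_smul,
    Equiv.swap_comm m i, dunkl_swap]
  abel

theorem dunkl_permAct_swap_sum {m i : Fin N} (hi : m ≠ i) {s : Finset (Fin N)} (hs : m ∉ s)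
    (f : Poly N) : ∑ l ∈ s, permAct (Equiv.swap l i) (dunkl m f)
      = dunkl m (∑ l ∈ s, permAct (Equiv.swap l i) f) := by
  rw [dunkl_sum]
  exact Finset.sum_congr rfl fun l hl =>
    (dunkl_swap_of_ne (ne_of_mem_of_not_mem hl hs).symm hi f).symm

/-- Since θ_m(m) is the first index, its Murphy sum is empty. In x_m D_m f = U_m f - f - κ ∑_{j>m}
(m j) f the last sum is killed by D_m, because D_m (m j) f = (m j) D_j f. -/
theorem opU_theta_dunkl_self {m : Fin N} {f : Poly N} (hf : ∀ j, m < j → dunkl j f = 0) :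
    opU (theta m m) (permAct (theta m) (dunkl m f))
      = permAct (theta m) (dunkl m (opU m f - f)) := by
  rw [opU_permAct, Finset.filter_false_of_mem fun l _ => by simp [theta_lt_theta]]
  congr 1
  have h1 : ∑ j ∈ Finset.univ.erase m, permAct (Equiv.swap m j) f
      = ∑ j ∈ Finset.univ.filter (fun j => j < m), permAct (Equiv.swap j m) f
        + ∑ j ∈ Finset.univ.filter (fun j => m < j), permAct (Equiv.swap m j) f := by
    rw [← Finset.sum_filter_add_sum_filter_not _ fun j => j < m]
    congr 1
    · refine Finset.sum_congr ?_ fun j _ => by rw [Equiv.swap_comm]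
      ext j
      simp
      omega
    · refine Finset.sum_congr ?_ fun j _ => rfl
      ext j
      simp
      omega
  have h2 : dunkl m (∑ j ∈ Finset.univ.filter (fun j => m < j), permAct (Equiv.swap m j) f)
      = 0 := by
    rw [dunkl_sum]
    refine Finset.sum_eq_zero fun j hj => ?_
    rw [dunkl_swap, hf j (by simpa using hj)]
    exact map_zero (rename (Equiv.swap m j))
  have h3 : X m * dunkl m f = opU m f - f
      - kappa • ∑ j ∈ Finset.univ.filter (fun j => m < j), permAct (Equiv.swap m j) f := by
    rw [opU, dunkl_X_mul_self, h1, smul_add]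
    abel
  rw [Finset.sum_empty, smul_zero, sub_zero, dunklX_apply, h3, dunkl_sub, dunkl_smul, h2,
    smul_zero, sub_zero]

/-- The commutator κ (i m) D_m of D_i x_i with D_m must be absorbed. For i < m the cycle adds
exactly this transposition to the Murphy sum; for i > m it is already there, and D_m (m i) f = (m i)
D_i f = 0. -/
theorem opU_theta_dunkl_of_ne {m i : Fin N} (hi : i ≠ m) {f : Poly N}
    (hf : ∀ j, m < j → dunkl j f = 0) :
    opU (theta m i) (permAct (theta m) (dunkl m f)) = permAct (theta m) (dunkl m (opU i f)) := by
  rw [opU_permAct]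
  congr 1
  rw [dunklX_dunkl_of_ne hi]
  rcases lt_or_gt_of_ne hi with hlt | hgt
  · have h1 : Finset.univ.filter (fun l => theta m l < theta m i)
        = insert m (Finset.univ.filter fun l => l < i) := by
      ext l
      simp [theta_lt_theta, hi]
      omega
    have h2 : m ∉ Finset.univ.filter fun l => l < i := by simp [hlt.le]
    rw [h1, Finset.sum_insert h2, dunkl_permAct_swap_sum hi.symm h2, opU, dunkl_sub, dunkl_smul,
      dunklX_apply, Equiv.swap_comm i m, smul_add]
    abel
  · have h1 : Finset.univ.filter (fun l => theta m l < theta m i)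
        = Finset.univ.filter fun l => l < i := by
      ext l
      simp [theta_lt_theta, hi]
      omega
    have h2 : m ∈ Finset.univ.filter fun l => l < i := by simp [hgt]
    rw [h1, ← Finset.add_sum_erase _ _ h2, dunkl_permAct_swap_sum hi.symm (by simp), opU,
      ← Finset.add_sum_erase _ _ h2, dunkl_sub, dunkl_smul, dunkl_add, dunkl_swap, hf i hgt,
      dunklX_apply, Equiv.swap_comm i m, smul_add, smul_add]
    simp only [permAct, map_zero, smul_zero]
    abel

theorem rank_eq_card (α : Fin N → ℕ) (i : Fin N) :
    rank α i = (Finset.univ.filter fun j => α i < α j ∨ (j ≤ i ∧ α j = α i)).card := by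
  rw [rank, ← Finset.card_union_of_disjoint, ← Finset.filter_or]
  rw [Finset.disjoint_left]
  intro k
  simp
  omega

theorem shift_theta (α : Fin N → ℕ) (m i : Fin N) :
    shift m α (theta m i) = (α - Pi.single m 1 : Fin N → ℕ) i := by
  simp [shift, compAct]

/-- Lowering α_m by 1 creates new ties, but moving it to the front resolves them as before; entries
after m are zero and never tie with α_m > 0. -/
theorem rank_shift {α : Fin N → ℕ} {m : Fin N} (hm : HasLength α m) (i : Fin N) :
    rank (shift m α) (theta m i) = rank α i := by
  have h0 : 0 < α m := hm.1
  have h1 : ∀ j, m < j → α j = 0 := fun j hj => by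
    by_contra h
    exact absurd (hm.2 (Nat.pos_of_ne_zero h)) (not_le.2 hj)
  rw [rank_eq_card, rank_eq_card]
  symm
  refine Finset.card_equiv (theta m) fun l => ?_
  simp only [Finset.mem_filter_univ, shift_theta]
  rw [← not_lt (a := theta m i), theta_lt_theta]
  have h2 : (α - Pi.single m 1 : Fin N → ℕ) m = α m - 1 := by simp
  have h3 : ∀ k, k ≠ m → (α - Pi.single m 1 : Fin N → ℕ) k = α k := fun k hk => by simp [hk]
  by_cases hi : i = m
  · subst hi
    by_cases hl : l = i
    · subst hl
      simp
    · have := h1 l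
      rw [h2, h3 l hl]
      omega
  · by_cases hl : l = m
    · subst hl
      have := h1 i
      rw [h2, h3 i hi]
      omega
    · rw [h3 l hl, h3 i hi]
      omega

theorem xi_shift_self {α : Fin N → ℕ} {m : Fin N} (hm : HasLength α m) :
    xi (shift m α) (theta m m) = xi α m - 1 := by
  have h0 : 0 < α m := hm.1
  have h : (α m : K) = (α m - 1 : ℕ) + 1 := by exact_mod_cast (by omega : α m = α m - 1 + 1)
  rw [xi, xi, rank_shift hm, shift_theta, h]
  simp
  ring

theorem xi_shift_of_ne {α : Fin N → ℕ} {m i : Fin N} (hm : HasLength α m) (hi : i ≠ m) :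
    xi (shift m α) (theta m i) = xi α i := by
  rw [xi, xi, rank_shift hm, shift_theta]
  simp [hi]

/-! ### Leading term and identification of θ_m D_m ζ_α -/

/-- By the support bound, every p_β in the expansion of ζ_α has β_j = 0. -/
theorem dunkl_zeta_eq_zero {α : Fin N → ℕ} {j : Fin N} (h : ∀ k, j ≤ k → α k = 0) :
    dunkl j (zeta α) = 0 := by
  have hle : Submodule.span K (p '' {β | StrongGT β α}) ≤ LinearMap.ker (dunklLin j) := by
    rw [Submodule.span_le]
    rintro _ ⟨β, hβ, rfl⟩
    exact dunkl_p_of_eq_zero (hβ.2 j h)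
  have h1 : dunkl j (zeta α - p α) = 0 := hle (zeta_sub_mem α)
  rwa [dunkl_sub, dunkl_p_of_eq_zero (h j le_rfl), sub_zero] at h1

theorem sub_single_add_single {α : Fin N → ℕ} {m : Fin N} (h : α m ≠ 0) :
    α - Pi.single m 1 + Pi.single m 1 = α := by
  ext x
  by_cases hx : x = m
  · subst hx
    simp
    omega
  · simp [hx]

/-- Leading term of `D_m ζ_α`. -/
theorem dunkl_zeta_sub_mem {α : Fin N → ℕ} {m : Fin N} (hm : α m ≠ 0)
    (hα : ∀ j, m < j → α j = 0) :
    dunkl m (zeta α)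
      - (((N : K) + 1 - (rank α m : K)) * kappa + (α m : K)) • p (α - Pi.single m 1)
      ∈ Submodule.span K (p '' {γ | TriangleGT (γ + Pi.single m 1) α}) := by
  set S := Submodule.span K (p '' {γ : Fin N → ℕ | TriangleGT (γ + Pi.single m 1) α})
  have hle : Submodule.span K (p '' {β | StrongGT β α}) ≤ S.comap (dunklLin m) := by
    rw [Submodule.span_le]
    rintro _ ⟨β, hβ, rfl⟩
    change dunkl m (p β) ∈ S
    by_cases hβm : β m = 0
    · rw [dunkl_p_of_eq_zero hβm]
      exact S.zero_mem
    · have h1 := dunkl_p_sub_mem hβm fun j hj => hβ.2 j fun k hk => hα k (hj.trans_le hk)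
      have h2 : p (β - Pi.single m 1) ∈ S := Submodule.subset_span ⟨_, by
        rw [Set.mem_ofPred_eq, sub_single_add_single hβm]
        exact hβ.1, rfl⟩
      have h3 : Submodule.span K (p '' {γ | TriangleGT (γ + Pi.single m 1) β}) ≤ S :=
        Submodule.span_mono (Set.image_mono fun γ hγ => TriangleGT.trans hγ hβ.1)
      rw [← sub_add_cancel (dunkl m (p β)) _]
      exact S.add_mem (h3 h1) (S.smul_mem _ h2)
  have h1 : dunkl m (zeta α - p α) ∈ S := hle (zeta_sub_mem α)
  have h2 := S.add_mem h1 (dunkl_p_sub_mem hm hα)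
  rw [dunkl_sub] at h2
  convert h2 using 1
  abel

theorem compAct_injective (w : Equiv.Perm (Fin N)) : Function.Injective (compAct w) := by
  intro α β h
  ext i
  simpa [compAct] using congrFun h (w i)

theorem sum_compAct (w : Equiv.Perm (Fin N)) (α : Fin N → ℕ) : ∑ i, compAct w α i = ∑ i, α i :=
  Equiv.sum_comp w⁻¹ α

/-- Leading term of `θ_m D_m ζ_α`. -/
theorem theta_dunkl_zeta_sub_mem {α : Fin N → ℕ} {m : Fin N} (hm : α m ≠ 0)
    (hα : ∀ j, m < j → α j = 0) :
    permAct (theta m) (dunkl m (zeta α))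
      - (((N : K) + 1 - (rank α m : K)) * kappa + (α m : K)) • p (shift m α)
      ∈ Submodule.span K (p '' {γ | ∑ i, γ i = ∑ i, shift m α i ∧ γ ≠ shift m α}) := by
  set S := Submodule.span K
    (p '' {γ : Fin N → ℕ | ∑ i, γ i = ∑ i, shift m α i ∧ γ ≠ shift m α})
  have hle : Submodule.span K (p '' {γ | TriangleGT (γ + Pi.single m 1) α})
      ≤ S.comap (permLin (theta m)) := by
    rw [Submodule.span_le]
    rintro _ ⟨γ, hγ, rfl⟩
    change permAct (theta m) (p γ) ∈ S
    rw [permAct_p]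
    refine Submodule.subset_span ⟨_, ⟨?_, fun h => ?_⟩, rfl⟩
    · rw [shift, sum_compAct, sum_compAct]
      have h1 := hγ.1
      rw [← sub_single_add_single hm] at h1
      simp only [Pi.add_apply, Finset.sum_add_distrib] at h1
      exact add_right_cancel h1
    · have h1 : γ = α - Pi.single m 1 := compAct_injective _ h
      rw [Set.mem_ofPred_eq, h1, sub_single_add_single hm] at hγ
      exact TriangleGT.irrefl α hγ
  have h1 : permAct (theta m) _ ∈ S := hle (dunkl_zeta_sub_mem hm hα)
  rwa [permAct_sub, permAct_smul, permAct_p] at h1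

theorem theta_dunkl_zeta {α : Fin N → ℕ} {m : Fin N} (hm : HasLength α m) :
    permAct (theta m) (dunkl m (zeta α))
      = (((N : K) + 1 - (rank α m : K)) * kappa + (α m : K)) • zeta (shift m α) := by
  have hm0 : α m ≠ 0 := (show 0 < α m from hm.1).ne'
  have hα : ∀ j, m < j → α j = 0 := fun j hj => by
    by_contra h
    exact absurd (hm.2 (Nat.pos_of_ne_zero h)) (not_le.2 hj)
  set g := permAct (theta m) (dunkl m (zeta α)) with hg
  set c := ((N : K) + 1 - (rank α m : K)) * kappa + (α m : K)
  have hlead := theta_dunkl_zeta_sub_mem hm0 hα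
  rw [← hg] at hlead
  have hD : ∀ j, m < j → dunkl j (zeta α) = 0 := fun j hj =>
    dunkl_zeta_eq_zero fun k hk => hα k (hj.trans_le hk)
  have hζ := isPMonicJack_zeta α
  have hζ' := isPMonicJack_zeta (shift m α)
  have hU : ∀ i, opULin i g = xi (shift m α) i • g := by
    intro i
    obtain ⟨i, rfl⟩ := (theta m).surjective i
    rw [opULin_apply]
    by_cases hi : i = m
    · subst hi
      rw [xi_shift_self hm, hg, opU_theta_dunkl_self hD, hζ.1, dunkl_sub, dunkl_smul,
        permAct_sub, permAct_smul, sub_smul, one_smul]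
    · rw [xi_shift_of_ne hm hi, hg, opU_theta_dunkl_of_ne hi hD, hζ.1, dunkl_smul, permAct_smul]
  have hmem : g ∈ Submodule.span K (p '' {γ | ∑ i, γ i = ∑ i, shift m α i}) := by
    have h1 := Submodule.span_mono (Set.image_mono (f := p) fun γ
      (h : ∑ i, γ i = ∑ i, shift m α i ∧ γ ≠ shift m α) => h.1) hlead
    rw [← sub_add_cancel g (c • p (shift m α))]
    exact Submodule.add_mem _ h1 (Submodule.smul_mem _ _ (Submodule.subset_span ⟨_, rfl, rfl⟩))
  obtain ⟨c', hc'⟩ := eigenvector_eq_smul (U := opULin) (v := p) (ξ := xi) (R := TriangleGT)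
    TriangleGT.irrefl (fun _ _ _ => TriangleGT.trans) opU_p_sub_mem_triangleGT xi_injective
    (finite_sum_eq _) (fun b hb c hc => hc.1.trans hb) hmem hU hζ'.2
    (fun i => by rw [opULin_apply]; exact hζ'.1 i)
  -- Otherwise p_α̃ would lie in the span of the other p_γ, against linear independence.
  have hcc : c' = c := by
    by_contra hne
    have h1 : Submodule.span K (p '' {β | TriangleGT β (shift m α)})
        ≤ Submodule.span K (p '' {γ | ∑ i, γ i = ∑ i, shift m α i ∧ γ ≠ shift m α}) :=
      Submodule.span_mono (Set.image_mono fun β hβ =>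
        ⟨hβ.1, fun h => TriangleGT.irrefl (shift m α) (h ▸ hβ)⟩)
    have h2 := Submodule.sub_mem _ hlead (Submodule.smul_mem _ c' (h1 hζ'.2))
    rw [hc', smul_sub, show ∀ a b d : Poly N, a - b - (a - d) = d - b by intros; abel,
      ← sub_smul] at h2
    have h3 := (Submodule.smul_mem_iff _ (sub_ne_zero.2 hne)).1 h2
    refine linearIndependent_p.notMem_span_image (x := shift m α) ?_ h3
    exact fun h => h.2 rfl
  rw [hc', hcc]

end NonsymJack

theorem mainTheorem6 {N : ℕ} (α : Fin N → ℕ) (m : Fin N) (hm : NonsymJack.HasLength α m) :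
    (∀ β : Fin N → ℕ, ∃! f : NonsymJack.Poly N, NonsymJack.IsPMonicJack β f) ∧
    NonsymJack.dunkl m (NonsymJack.zeta α) =
      (((N : NonsymJack.K) + 1 - (NonsymJack.rank α m : NonsymJack.K)) * NonsymJack.kappa
          + (α m : NonsymJack.K)) •
        NonsymJack.permAct (NonsymJack.theta m)⁻¹
          (NonsymJack.zeta (NonsymJack.shift m α)) := by
  refine ⟨NonsymJack.existsUnique_jack, ?_⟩
  rw [← NonsymJack.permAct_smul, ← NonsymJack.theta_dunkl_zeta hm, NonsymJack.permAct_permAct,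
    inv_mul_cancel, NonsymJack.permAct_one]
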